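/- Let $G$ be a finite group. For a finite group $H$ let $A(H)$ be its Burnside ring, the ring of formal differences of isomorphism classes of finite $H$-sets (sum: disjoint union, product: Cartesian product), and for $I\le H$ let $\varphi_H^I\colon A(H)\to\mathbb Z$ be the ring homomorphism with $X\mapsto |X^I|$; for $p$ a prime or $0$ let $\varphi_{H,p}^I\colon A(H)\to\mathbb Z/p\mathbb Z$ be its reduction modulo $p$. The Burnside Tambara functor $\underline A_G$ has the values $\underline A_G(G/H)=A(H)$ for $H\le G$ and, for $K\le H\le G$ and $g\in G$, the following structure maps: * the restriction $\mathrm{res}^H_K\colon A(H)\to A(K)$; * the transfer $\mathrm{tr}_K^H\colon A(K)\to A(H)$, $X\mapsto H\times_K X$; * the norm $N_K^H\colon A(K)\to A(H)$, the unique polynomial extension of $X\mapsto \mathrm{Map}_K(H,X)$ to formal differences; * the conjugation $c_{g,H}\colon A(H)\to A(H^g)$, where $H^g=g^{-1}Hg$ and $x\in H^g$ acts on $c_{g,H}(X)=X$ as $gxg^{-1}$. An ideal $\mathcal I$ of $\underline A_G$ is a family of ring ideals $\mathcal I(G/H)\subseteq A(H)$, $H\le G$, such that $\mathrm{res}^H_K\,\mathcal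 I(G/H)\subseteq\mathcal I(G/K)$, $\mathrm{tr}_K^H\,\mathcal I(G/K)\subseteq\mathcal I(G/H)$, $N_K^H\,\mathcal I(G/K)\subseteq \mathcal I(G/H)+N_K^H(0)$ and $c_{g,H}\,\mathcal I(G/H)\subseteq\mathcal I(G/H^g)$ for all $K\le H\le G$ and $g\in G$. Inclusion of ideals is levelwise. The product $\mathcal I\mathcal J$ of two ideals has as its value at $G/H$ the set of all finite sums $\sum_i \mathrm{tr}_{K_i^{g_i}}^{H}\,c_{g_i,K_i}(a_ib_i)$ with $K_i\le G$, $g_i\in G$, $K_i^{g_i}\le H$, $a_i\in\mathcal I(G/K_i)$ and $b_i\in\mathcal J(G/K_i)$. An ideal $\mathcal P\ne\underline A_G$ is prime if $\mathcal I\mathcal J\subseteq\mathcal P$ implies $\mathcal I\subseteq\mathcal P$ or $\mathcal J\subseteq\mathcal P$ for all ideals $\mathcal I,\mathcal J$ of $\underline A_G$, and $\operatorname{Spec}(\underline A_G)$ is the set of prime ideals of $\underline A_G$. For $C\le G$ and $p$ a prime or $0$ define the family $\mathfrak p_{C,p}$ by $$\mathfrak p_{C,p}(G/H)=\bigcap_{\substack{I\le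 H\\ I^g\le C\text{ for some }g\in G}}\ker\bigl(\varphi^I_{H,p}\bigr)\qquad(H\le G).$$ **Theorem.** If $G$ is a finite cyclic group, then $$\operatorname{Spec}(\underline A_G)=\{\mathfrak p_{C,p}\mid C\le G,\ p\text{ a prime or }0\}.$$ -/

import Mathlib

universe u

/-! ### The Grothendieck ring of a commutative semiring -/

/-- The ring of formal differences of elements of a commutative semiring `R`: its underlying
additive group is the Grothendieck group of the additive monoid of `R`. -/
def GrothendieckRing (R : Type*) [CommSemiring R] : Type _ :=
  Algebra.GrothendieckAddGroup R

namespace GrothendieckRing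

section Ring

variable {R : Type*} [CommSemiring R]

noncomputable instance instAddCommGroup : AddCommGroup (GrothendieckRing R) :=
  inferInstanceAs (AddCommGroup (Algebra.GrothendieckAddGroup R))

/-- The class of an element of the semiring. -/
noncomputable def ofAdd : R →+ GrothendieckRing R :=
  (Algebra.GrothendieckAddGroup.of : R →+ Algebra.GrothendieckAddGroup R)

/-- The universal property of the underlying additive group. -/
noncomputable def liftAdd {B : Type*} [AddCommGroup B] (f : R →+ B) : GrothendieckRing R →+ B :=
  (Algebra.GrothendieckAddGroup.lift f : Algebra.GrothendieckAddGroup R →+ B)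

@[simp] theorem liftAdd_ofAdd {B : Type*} [AddCommGroup B] (f : R →+ B) (x : R) :
    liftAdd f (ofAdd x) = f x :=
  DFunLike.congr_fun (Algebra.GrothendieckAddGroup.lift.symm_apply_apply f) x

theorem mk_eq (x : R) (y : (⊤ : AddSubmonoid R)) :
    (AddLocalization.mk x y : GrothendieckRing R) = ofAdd x - ofAdd (y : R) := by
  have h := (AddLocalization.mk_eq_addMonoidOf_mk' (S := (⊤ : AddSubmonoid R)))
  have h2 : ((AddLocalization.mk x y : Algebra.GrothendieckAddGroup R)) +
      (Algebra.GrothendieckAddGroup.of (y : R)) = Algebra.GrothendieckAddGroup.of x := by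
    rw [h]
    exact (AddLocalization.addMonoidOf (⊤ : AddSubmonoid R)).mk'_spec x y
  exact eq_sub_of_add_eq h2

/-- Every element is a formal difference of elements of the semiring. -/
theorem exists_eq_sub (a : GrothendieckRing R) : ∃ x y : R, a = ofAdd x - ofAdd y := by
  induction a using AddLocalization.ind with
  | H y => exact ⟨y.1, y.2, mk_eq y.1 y.2⟩

theorem addHom_ext {B : Type*} [AddCommGroup B] {f g : GrothendieckRing R →+ B}
    (h : ∀ x, f (ofAdd x) = g (ofAdd x)) : f = g := by
  ext a
  obtain ⟨x, y, rfl⟩ := exists_eq_sub a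
  simp [h]

/-- The biadditive extension of the multiplication of the semiring. -/
noncomputable def mulHom : GrothendieckRing R →+ GrothendieckRing R →+ GrothendieckRing R :=
  liftAdd
    { toFun := fun x => liftAdd (ofAdd.comp (AddMonoidHom.mulLeft x))
      map_zero' := addHom_ext fun y => by simp
      map_add' := fun x y => addHom_ext fun z => by simp [add_mul] }

noncomputable instance : Mul (GrothendieckRing R) := ⟨fun a b => mulHom a b⟩

noncomputable instance : One (GrothendieckRing R) := ⟨ofAdd 1⟩

theorem mul_def (a b : GrothendieckRing R) : a * b = mulHom a b := rfl

theorem one_def : (1 : GrothendieckRing R) = ofAdd 1 := rfl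

theorem ofAdd_mul (x y : R) : ofAdd (x * y) = ofAdd x * ofAdd y := by
  simp [mul_def, mulHom]

theorem left_distrib' (a b c : GrothendieckRing R) : a * (b + c) = a * b + a * c := by
  simp [mul_def]

theorem right_distrib' (a b c : GrothendieckRing R) : (a + b) * c = a * c + b * c := by
  simp [mul_def]

theorem mul_sub' (a b c : GrothendieckRing R) : a * (b - c) = a * b - a * c := by
  simp [mul_def]

theorem sub_mul' (a b c : GrothendieckRing R) : (a - b) * c = a * c - b * c := by
  simp [mul_def]

theorem mul_comm' (a b : GrothendieckRing R) : a * b = b * a := by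
  obtain ⟨x, y, rfl⟩ := exists_eq_sub a
  obtain ⟨z, w, rfl⟩ := exists_eq_sub b
  simp only [mul_sub', sub_mul', ← ofAdd_mul, mul_comm x, mul_comm y]
  abel

theorem mul_assoc' (a b c : GrothendieckRing R) : a * b * c = a * (b * c) := by
  obtain ⟨x, y, rfl⟩ := exists_eq_sub a
  obtain ⟨z, w, rfl⟩ := exists_eq_sub b
  obtain ⟨s, t, rfl⟩ := exists_eq_sub c
  simp only [mul_sub', sub_mul', ← ofAdd_mul, mul_assoc]

theorem one_mul' (a : GrothendieckRing R) : 1 * a = a := by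
  obtain ⟨x, y, rfl⟩ := exists_eq_sub a
  simp only [mul_sub', one_def, ← ofAdd_mul, one_mul]

noncomputable instance : CommRing (GrothendieckRing R) :=
  { instAddCommGroup (R := R) with
    mul := (· * ·)
    one := 1
    left_distrib := left_distrib'
    right_distrib := right_distrib'
    zero_mul := fun a => by simp [mul_def]
    mul_zero := fun a => by simp [mul_def]
    mul_assoc := mul_assoc'
    one_mul := one_mul'
    mul_one := fun a => by rw [mul_comm', one_mul']
    mul_comm := mul_comm' }

/-- The canonical map from the semiring to its Grothendieck ring. -/
noncomputable def of : R →+* GrothendieckRing R :=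
  { ofAdd with
    map_one' := rfl
    map_mul' := ofAdd_mul }

theorem of_eq_ofAdd (x : R) : of x = ofAdd x := rfl

/-- The extension of a homomorphism from the semiring to a ring. -/
noncomputable def lift {S : Type*} [CommRing S] (f : R →+* S) : GrothendieckRing R →+* S :=
  { liftAdd (f : R →+ S) with
    map_one' := by
      show liftAdd (f : R →+ S) (ofAdd 1) = 1
      simp
    map_mul' := fun a b => by
      show liftAdd (f : R →+ S) (a * b) = liftAdd (f : R →+ S) a * liftAdd (f : R →+ S) b
      obtain ⟨x, y, rfl⟩ := exists_eq_sub a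
      obtain ⟨z, w, rfl⟩ := exists_eq_sub b
      simp only [mul_sub', sub_mul', ← ofAdd_mul, map_sub, liftAdd_ofAdd]
      simp [mul_sub, sub_mul] }

@[simp] theorem lift_of {S : Type*} [CommRing S] (f : R →+* S) (x : R) : lift f (of x) = f x :=
  liftAdd_ofAdd (f : R →+ S) x

end Ring

/-! ### Extension of polynomial maps to formal differences

A map `f` from an additive monoid to an abelian group whose iterated differences
`Δ_y^{n+1} f` all vanish has a unique extension to formal differences with the same property.
It is given by Newton's forward difference series, evaluated at `-1`:
`f (x - y) = ∑_{j ≤ n} (-1)^j (Δ_y^j f) (x)`. -/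

section Newton

variable {M B : Type*} [AddCommMonoid M] [AddCommGroup B]

/-- Newton's forward difference series of `f`, for the value at `x - y`. -/
def newton (n : ℕ) (f : M → B) (x y : M) : B :=
  ∑ j ∈ Finset.range (n + 1), (-1 : ℤ) ^ j • ((fwdDiff y)^[j] f) x

/-- `f` is polynomial of degree at most `n` along each direction. -/
def IsPolynomial (n : ℕ) (f : M → B) : Prop :=
  ∀ y : M, (fwdDiff y)^[n + 1] f = 0

noncomputable abbrev diffEnd (B : Type*) [AddCommGroup B] (y : M) : Module.End ℤ (M → B) := fwdDiff_aux.fwdDiffₗ M B y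

theorem diffEnd_comm (B : Type*) [AddCommGroup B] (y z : M) : Commute (diffEnd B y) (diffEnd B z) := by
  apply LinearMap.ext
  intro f
  funext x
  simp only [Module.End.mul_apply, fwdDiff_aux.fwdDiffₗ_apply, fwdDiff, add_right_comm x y z]
  abel

noncomputable abbrev newtonEnd (B : Type*) [AddCommGroup B] (n : ℕ) (y : M) : Module.End ℤ (M → B) :=
  ∑ j ∈ Finset.range (n + 1), (-diffEnd B y) ^ j

theorem newton_eq (n : ℕ) (f : M → B) (x y : M) : newton n f x y = (newtonEnd B n y f) x := by
  rw [newton, LinearMap.sum_apply, Finset.sum_apply]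
  refine Finset.sum_congr rfl fun j _ => ?_
  rw [neg_pow (diffEnd B y)]
  have h : ((-1 : Module.End ℤ (M → B)) ^ j) = (((-1 : ℤ) ^ j : ℤ) : Module.End ℤ (M → B)) := by
    push_cast; rfl
  rw [h, Module.End.mul_apply, Module.End.intCast_apply, Pi.smul_apply,
    Module.End.pow_apply, fwdDiff_aux.coe_fwdDiffₗ]

theorem newtonEnd_mul (n : ℕ) (f : M → B) (hf : IsPolynomial n f) (y : M) :
    newtonEnd B n y ((diffEnd B y + 1) f) = f := by
  have h := geom_sum_mul_neg (-diffEnd B y) (n + 1)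
  have h2 := LinearMap.congr_fun h f
  rw [Module.End.mul_apply] at h2
  have h3 : ((1 : Module.End ℤ (M → B)) - -diffEnd B y) = diffEnd B y + 1 := by abel
  rw [h3] at h2
  rw [h2, neg_pow, LinearMap.sub_apply, Module.End.mul_apply, Module.End.pow_apply (diffEnd B y),
    fwdDiff_aux.coe_fwdDiffₗ, hf y]
  simp

theorem newtonEnd_comm_diffEnd (B : Type*) [AddCommGroup B] (n : ℕ) (y z : M) : Commute (newtonEnd B n y) (diffEnd B z) :=
  (Commute.sum_right _ _ _ fun _ _ => ((diffEnd_comm B z y).neg_right).pow_right _).symm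

theorem newtonEnd_comm_NS (B : Type*) [AddCommGroup B] (n : ℕ) (y z : M) : Commute (newtonEnd B n y) (newtonEnd B n z) :=
  Commute.sum_right _ _ _ fun _ _ => ((newtonEnd_comm_diffEnd B n y z).neg_right).pow_right _

/-- Adding the same element to `x` and to `y` does not change the value at `x - y`. -/
theorem newton_add_right {n : ℕ} {f : M → B} (hf : IsPolynomial n f) (x y z : M) :
    newton n f (x + z) (y + z) = newton n f x y := by
  have e (w : M) : diffEnd B w + 1 = fwdDiff_aux.shiftₗ M B w := rfl
  have hs : (diffEnd B (y + z) + 1) f = (diffEnd B z + 1) ((diffEnd B y + 1) f) := by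
    funext w
    simp only [e, fwdDiff_aux.shiftₗ_apply]
    congr 1
    abel
  have h1 : newton n f (x + z) (y + z) = ((diffEnd B z + 1) (newtonEnd B n (y + z) f)) x := by
    rw [e, fwdDiff_aux.shiftₗ_apply, newton_eq]
  have c1 : Commute (newtonEnd B n y * newtonEnd B n (y + z)) (diffEnd B z + 1) :=
    ((newtonEnd_comm_diffEnd B n y z).mul_left (newtonEnd_comm_diffEnd B n (y + z) z)).add_right (Commute.one_right _)
  have h2 : newtonEnd B n y f = (diffEnd B z + 1) (newtonEnd B n (y + z) f) := by
    conv_lhs => rw [← newtonEnd_mul n f hf (y + z), hs]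
    rw [← Module.End.mul_apply, ← Module.End.mul_apply, c1.eq, (newtonEnd_comm_NS B n y (y + z)).eq]
    simp only [Module.End.mul_apply]
    rw [newtonEnd_mul n f hf y]
  rw [h1, newton_eq, h2]

theorem newton_zero (n : ℕ) (f : M → B) (x : M) : newton n f x 0 = f x := by
  have h : fwdDiff (0 : M) f = 0 := by
    funext w
    simp [fwdDiff]
  have h0 : fwdDiff (0 : M) (0 : M → B) = 0 := by
    funext w
    simp [fwdDiff]
  rw [newton, Finset.sum_range_succ', Finset.sum_eq_zero]
  · simp
  · intro j _
    rw [Function.iterate_succ_apply, h, Function.iterate_fixed h0]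
    simp

end Newton

/-- The extension of a polynomial map of degree at most `n` to formal differences. -/
noncomputable def extend {R B : Type*} [CommSemiring R] [AddCommGroup B] (n : ℕ) (f : R → B)
    (hf : IsPolynomial n f) : GrothendieckRing R → B :=
  fun a => AddLocalization.liftOn (p := B) a (fun x y => newton n f x y) (by
    intro x x' y y' h
    obtain ⟨c, hc⟩ := AddLocalization.r_iff_exists.mp h
    show newton n f x y = newton n f x' y'
    rw [← newton_add_right hf x (y : R) (c + y' : R), ← newton_add_right hf x' (y' : R) (c + y : R)]
    congr 1
    · rw [add_left_comm, add_comm x, hc]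
      abel
    · abel)

theorem extend_sub {R B : Type*} [CommSemiring R] [AddCommGroup B] (n : ℕ) (f : R → B)
    (hf : IsPolynomial n f) (x y : R) : extend n f hf (of x - of y) = newton n f x y := by
  rw [of_eq_ofAdd, of_eq_ofAdd, ← mk_eq x ⟨y, AddSubmonoid.mem_top y⟩]
  rfl

/-- The extension has the given values on the elements of the semiring. -/
theorem extend_of {R B : Type*} [CommSemiring R] [AddCommGroup B] (n : ℕ) (f : R → B)
    (hf : IsPolynomial n f) (x : R) : extend n f hf (of x) = f x := by
  rw [← newton_zero n f x, ← extend_sub n f hf x 0, map_zero, sub_zero]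

end GrothendieckRing

/-! ### Finite `H`-sets -/

/-- A finite set with an action of the group `H`. -/
structure FinGSet (H : Type u) [Group H] where
  carrier : Type u
  [action : MulAction H carrier]
  [finite : Finite carrier]

namespace FinGSet

attribute [instance] FinGSet.action FinGSet.finite

instance (H : Type u) [Group H] : CoeSort (FinGSet H) (Type u) := ⟨carrier⟩

section Basic

variable {H : Type u} [Group H]

/-- Isomorphism of finite `H`-sets: there is an equivariant bijection. -/
def Iso (X Y : FinGSet H) : Prop := ∃ e : X ≃ Y, ∀ (h : H) (x : X), e (h • x) = h • e x

instance setoid (H : Type u) [Group H] : Setoid (FinGSet H) where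
  r := Iso
  iseqv :=
    { refl := fun X => ⟨Equiv.refl X, fun _ _ => rfl⟩
      symm := by
        rintro X Y ⟨e, he⟩
        exact ⟨e.symm, fun h y => by rw [Equiv.symm_apply_eq, he, Equiv.apply_symm_apply]⟩
      trans := by
        rintro X Y Z ⟨e, he⟩ ⟨f, hf⟩
        exact ⟨e.trans f, fun h x => by simp [he, hf]⟩ }

/-- The empty `H`-set. -/
def empty (H : Type u) [Group H] : FinGSet H where
  carrier := PEmpty
  action :=
    { smul := fun _ x => x
      one_smul := fun _ => rfl
      mul_smul := fun _ _ _ => rfl }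

/-- The one-point `H`-set. -/
def point (H : Type u) [Group H] : FinGSet H where
  carrier := PUnit
  action :=
    { smul := fun _ x => x
      one_smul := fun _ => rfl
      mul_smul := fun _ _ _ => rfl }

/-- The disjoint union of two `H`-sets. -/
def disjUnion (X Y : FinGSet H) : FinGSet H where
  carrier := X ⊕ Y
  action :=
    { smul := fun h => Sum.map (h • ·) (h • ·)
      one_smul := by
        rintro (x | y)
        · exact congrArg Sum.inl (one_smul H x)
        · exact congrArg Sum.inr (one_smul H y)
      mul_smul := by
        rintro a b (x | y)
        · exact congrArg Sum.inl (mul_smul a b x)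
        · exact congrArg Sum.inr (mul_smul a b y) }

/-- The product of two `H`-sets, with the diagonal action. -/
def prod (X Y : FinGSet H) : FinGSet H where
  carrier := X × Y
  action :=
    { smul := fun h z => (h • z.1, h • z.2)
      one_smul := fun z => Prod.ext (one_smul H z.1) (one_smul H z.2)
      mul_smul := fun a b z => Prod.ext (mul_smul a b z.1) (mul_smul a b z.2) }

/-- The restriction of an `H`-set along a group homomorphism `K → H`. -/
def restrict {K : Type u} [Group K] (φ : K →* H) (X : FinGSet H) : FinGSet K where
  carrier := X
  action := MulAction.compHom X φ

/-- The equivalence relation `(h k, x) ~ (h, k x)` on `H × X`, for `k` in `K`. -/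
def inducedSetoid {K : Type u} [Group K] (φ : K →* H) (X : FinGSet K) : Setoid (H × X) where
  r := fun a b => ∃ k : K, a.1 = b.1 * φ k ∧ b.2 = k • a.2
  iseqv :=
    { refl := fun a => ⟨1, by simp⟩
      symm := by
        rintro a b ⟨k, h1, h2⟩
        exact ⟨k⁻¹, by simp [h1], by simp [h2]⟩
      trans := by
        rintro a b c ⟨k, h1, h2⟩ ⟨l, h3, h4⟩
        exact ⟨l * k, by simp [h1, h3, mul_assoc], by simp [h4, h2, mul_smul]⟩ }

/-- The induced `H`-set `H ×_K X`, the quotient of `H × X` by `(h k, x) ~ (h, k x)`, with `H` acting on the first factor. -/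
def induced {K : Type u} [Group K] [Finite H] (φ : K →* H) (X : FinGSet K) : FinGSet H where
  carrier := Quotient (inducedSetoid φ X)
  action :=
    { smul := fun h => Quotient.map (fun a => (h * a.1, a.2)) (by
        rintro a b ⟨k, h1, h2⟩
        exact ⟨k, by simp [h1, mul_assoc], h2⟩)
      one_smul := by
        rintro ⟨a⟩
        exact congrArg (Quotient.mk _) (by simp)
      mul_smul := by
        rintro g h ⟨a⟩
        exact congrArg (Quotient.mk _) (by simp [mul_assoc]) }

/-- The coinduced `H`-set `Map_K(H, X)` of the maps `f : H → X` such that `f (k h) = k f(h)`,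
with `H` acting by `(h' f)(h) = f (h h')`. -/
def coinduced {K : Type u} [Group K] [Finite H] (φ : K →* H) (X : FinGSet K) : FinGSet H where
  carrier := {f : H → X // ∀ (k : K) (h : H), f (φ k * h) = k • f h}
  action :=
    { smul := fun g f => ⟨fun h => f.1 (h * g), fun k h =>
        (congrArg f.1 (mul_assoc (φ k) h g)).trans (f.2 k (h * g))⟩
      one_smul := fun f => Subtype.ext (funext fun h => congrArg f.1 (mul_one h))
      mul_smul := fun a b f => Subtype.ext (funext fun h => congrArg f.1 (mul_assoc h a b).symm) }

/-- The invariant subset cut out by an invariant predicate. -/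
def sub (X : FinGSet H) (p : X → Prop) (hp : ∀ (h : H) (x : X), p x → p (h • x)) : FinGSet H where
  carrier := {x : X // p x}
  action :=
    { smul := fun h x => ⟨h • x.1, hp h x.1 x.2⟩
      one_smul := fun x => Subtype.ext (one_smul H x.1)
      mul_smul := fun a b x => Subtype.ext (mul_smul a b x.1) }

/-- The disjoint union of copies of `X`, indexed by the finite set `S`. -/
def copies (S : Type) [Finite S] (X : FinGSet H) : FinGSet H where
  carrier := S × X
  action :=
    { smul := fun h z => (z.1, h • z.2)
      one_smul := fun z => Prod.ext rfl (one_smul H z.2)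
      mul_smul := fun a b z => Prod.ext rfl (mul_smul a b z.2) }

theorem disjUnion_congr {X X' Y Y' : FinGSet H} (hX : X ≈ X') (hY : Y ≈ Y') :
    disjUnion X Y ≈ disjUnion X' Y' := by
  obtain ⟨e, he⟩ := hX
  obtain ⟨f, hf⟩ := hY
  refine ⟨Equiv.sumCongr e f, ?_⟩
  rintro h (x | y)
  · exact congrArg Sum.inl (he h x)
  · exact congrArg Sum.inr (hf h y)

theorem prod_congr {X X' Y Y' : FinGSet H} (hX : X ≈ X') (hY : Y ≈ Y') :
    prod X Y ≈ prod X' Y' := by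
  obtain ⟨e, he⟩ := hX
  obtain ⟨f, hf⟩ := hY
  exact ⟨Equiv.prodCongr e f, fun h z => Prod.ext (he h z.1) (hf h z.2)⟩

theorem restrict_congr {K : Type u} [Group K] (φ : K →* H) {X X' : FinGSet H} (hX : X ≈ X') :
    restrict φ X ≈ restrict φ X' := by
  obtain ⟨e, he⟩ := hX
  exact ⟨e, fun k x => he (φ k) x⟩

theorem induced_congr {K : Type u} [Group K] [Finite H] (φ : K →* H) {X X' : FinGSet K}
    (hX : X ≈ X') : induced φ X ≈ induced φ X' := by
  obtain ⟨e, he⟩ := hX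
  refine ⟨Quotient.congr (Equiv.prodCongr (Equiv.refl H) e) ?_, ?_⟩
  · rintro ⟨a, x⟩ ⟨b, y⟩
    refine exists_congr fun k => and_congr Iff.rfl ?_
    show y = k • x ↔ e y = k • e x
    rw [← he, e.apply_eq_iff_eq]
  · rintro h ⟨a⟩
    rfl

theorem coinduced_congr {K : Type u} [Group K] [Finite H] (φ : K →* H) {X X' : FinGSet K}
    (hX : X ≈ X') : coinduced φ X ≈ coinduced φ X' := by
  obtain ⟨e, he⟩ := hX
  refine ⟨Equiv.subtypeEquiv (Equiv.piCongrRight fun _ => e) ?_, ?_⟩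
  · intro f
    refine forall_congr' fun k => forall_congr' fun h => ?_
    show f (φ k * h) = k • f h ↔ e (f (φ k * h)) = k • e (f h)
    rw [← he, e.apply_eq_iff_eq]
  · intro h f
    rfl

end Basic

end FinGSet

/-- The isomorphism classes of finite `H`-sets. -/
def FinGSetClass (H : Type u) [Group H] : Type (u + 1) := Quotient (FinGSet.setoid H)

namespace FinGSetClass

open FinGSet

section Basic

variable {H : Type u} [Group H]

/-- The isomorphism class of a finite `H`-set. -/
def mk (X : FinGSet H) : FinGSetClass H := Quotient.mk _ X

theorem mk_eq_mk {X Y : FinGSet H} : mk X = mk Y ↔ Iso X Y := Quotient.eq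

instance : Zero (FinGSetClass H) := ⟨mk (FinGSet.empty H)⟩

instance : One (FinGSetClass H) := ⟨mk (FinGSet.point H)⟩

instance : Add (FinGSetClass H) :=
  ⟨Quotient.map₂ disjUnion fun _ _ h _ _ h' => disjUnion_congr h h'⟩

instance : Mul (FinGSetClass H) :=
  ⟨Quotient.map₂ prod fun _ _ h _ _ h' => prod_congr h h'⟩

theorem mk_add (X Y : FinGSet H) : mk X + mk Y = mk (disjUnion X Y) := rfl

theorem mk_mul (X Y : FinGSet H) : mk X * mk Y = mk (prod X Y) := rfl

theorem zero_def : (0 : FinGSetClass H) = mk (FinGSet.empty H) := rfl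

theorem one_def : (1 : FinGSetClass H) = mk (FinGSet.point H) := rfl

theorem mk_empty (X : FinGSet H) [hX : IsEmpty X] : mk X = 0 :=
  mk_eq_mk.mpr ⟨Equiv.equivOfIsEmpty X PEmpty.{u + 1}, fun _ x => hX.elim x⟩

theorem add_comm' (a b : FinGSetClass H) : a + b = b + a := by
  rcases a with ⟨X⟩
  rcases b with ⟨Y⟩
  refine mk_eq_mk.mpr ⟨Equiv.sumComm X Y, ?_⟩
  rintro h (x | x) <;> rfl

theorem zero_add' (a : FinGSetClass H) : 0 + a = a := by
  rcases a with ⟨X⟩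
  refine mk_eq_mk.mpr ⟨Equiv.emptySum PEmpty.{u + 1} X, ?_⟩
  rintro h (x | x)
  · exact x.elim
  · rfl

theorem mul_comm' (a b : FinGSetClass H) : a * b = b * a := by
  rcases a with ⟨X⟩
  rcases b with ⟨Y⟩
  exact mk_eq_mk.mpr ⟨Equiv.prodComm X Y, fun h x => rfl⟩

theorem one_mul' (a : FinGSetClass H) : 1 * a = a := by
  rcases a with ⟨X⟩
  exact mk_eq_mk.mpr ⟨Equiv.punitProd X, fun h x => rfl⟩

theorem right_distrib' (a b c : FinGSetClass H) : (a + b) * c = a * c + b * c := by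
  rcases a with ⟨X⟩
  rcases b with ⟨Y⟩
  rcases c with ⟨Z⟩
  refine mk_eq_mk.mpr ⟨Equiv.sumProdDistrib X Y Z, ?_⟩
  rintro h ⟨x | x, z⟩ <;> rfl

theorem zero_mul' (a : FinGSetClass H) : 0 * a = 0 := by
  rcases a with ⟨X⟩
  exact mk_eq_mk.mpr ⟨Equiv.pemptyProd X, fun h x => x.1.elim⟩

instance : CommSemiring (FinGSetClass H) where
  add := (· + ·)
  zero := 0
  mul := (· * ·)
  one := 1
  nsmul := nsmulRec
  add_assoc := by
    rintro ⟨X⟩ ⟨Y⟩ ⟨Z⟩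
    refine mk_eq_mk.mpr ⟨Equiv.sumAssoc X Y Z, ?_⟩
    rintro h ((x | x) | x) <;> rfl
  zero_add := zero_add'
  add_zero := fun a => by rw [add_comm', zero_add']
  add_comm := add_comm'
  mul_assoc := by
    rintro ⟨X⟩ ⟨Y⟩ ⟨Z⟩
    exact mk_eq_mk.mpr ⟨Equiv.prodAssoc X Y Z, fun h x => rfl⟩
  one_mul := one_mul'
  mul_one := fun a => by rw [mul_comm', one_mul']
  mul_comm := mul_comm'
  left_distrib := fun a b c => by
    rw [mul_comm', right_distrib', mul_comm' b, mul_comm' c]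
  right_distrib := right_distrib'
  zero_mul := zero_mul'
  mul_zero := fun a => by rw [mul_comm', zero_mul']

/-- Restriction along a group homomorphism `K → H`. -/
def restrict {K : Type u} [Group K] (φ : K →* H) : FinGSetClass H →+* FinGSetClass K where
  toFun := Quotient.map (FinGSet.restrict φ) fun _ _ h => restrict_congr φ h
  map_zero' := mk_eq_mk.mpr ⟨Equiv.refl _, fun _ x => x.elim⟩
  map_one' := mk_eq_mk.mpr ⟨Equiv.refl _, fun _ _ => rfl⟩
  map_add' := by
    rintro ⟨X⟩ ⟨Y⟩
    refine mk_eq_mk.mpr ⟨Equiv.refl _, ?_⟩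
    rintro h (x | x) <;> rfl
  map_mul' := by
    rintro ⟨X⟩ ⟨Y⟩
    exact mk_eq_mk.mpr ⟨Equiv.refl _, fun _ _ => rfl⟩

/-- Induction along a group homomorphism `K → H`, on isomorphism classes. -/
def induced {K : Type u} [Group K] [Finite H] (φ : K →* H) : FinGSetClass K →+ FinGSetClass H where
  toFun := Quotient.map (FinGSet.induced φ) fun _ _ h => induced_congr φ h
  map_zero' := by
    have : IsEmpty (FinGSet.induced φ (FinGSet.empty K)) :=
      ⟨by rintro ⟨a⟩; exact PEmpty.elim a.2⟩
    exact mk_empty _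
  map_add' := by
    rintro ⟨X⟩ ⟨Y⟩
    let l : FinGSet.induced φ X → FinGSet.induced φ (disjUnion X Y) :=
      Quotient.map' (s₁ := inducedSetoid φ X) (s₂ := inducedSetoid φ (disjUnion X Y))
        (fun a => (a.1, Sum.inl a.2)) (by
          rintro a b ⟨k, h1, h2⟩
          exact ⟨k, h1, congrArg Sum.inl h2⟩)
    let r : FinGSet.induced φ Y → FinGSet.induced φ (disjUnion X Y) :=
      Quotient.map' (s₁ := inducedSetoid φ Y) (s₂ := inducedSetoid φ (disjUnion X Y))
        (fun a => (a.1, Sum.inr a.2)) (by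
          rintro a b ⟨k, h1, h2⟩
          exact ⟨k, h1, congrArg Sum.inr h2⟩)
    refine Eq.symm (mk_eq_mk.mpr ⟨Equiv.ofBijective (Sum.elim l r) ⟨?_, ?_⟩, ?_⟩)
    · rintro (a | a) (b | b) hab <;> rcases a with ⟨a⟩ <;> rcases b with ⟨b⟩
      · obtain ⟨k, h1, h2⟩ : inducedSetoid φ (disjUnion X Y) (a.1, Sum.inl a.2)
          (b.1, Sum.inl b.2) := Quotient.exact hab
        exact congrArg Sum.inl (Quotient.sound (s := inducedSetoid φ X)
          ⟨k, h1, Sum.inl_injective h2⟩)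
      · obtain ⟨k, h1, h2⟩ : inducedSetoid φ (disjUnion X Y) (a.1, Sum.inl a.2)
          (b.1, Sum.inr b.2) := Quotient.exact hab
        exact (Sum.inr_ne_inl h2).elim
      · obtain ⟨k, h1, h2⟩ : inducedSetoid φ (disjUnion X Y) (a.1, Sum.inr a.2)
          (b.1, Sum.inl b.2) := Quotient.exact hab
        exact (Sum.inl_ne_inr h2).elim
      · obtain ⟨k, h1, h2⟩ : inducedSetoid φ (disjUnion X Y) (a.1, Sum.inr a.2)
          (b.1, Sum.inr b.2) := Quotient.exact hab
        exact congrArg Sum.inr (Quotient.sound (s := inducedSetoid φ Y)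
          ⟨k, h1, Sum.inr_injective h2⟩)
    · rintro ⟨h, x | x⟩
      · exact ⟨Sum.inl (Quotient.mk (inducedSetoid φ X) (h, x)), rfl⟩
      · exact ⟨Sum.inr (Quotient.mk (inducedSetoid φ Y) (h, x)), rfl⟩
    · rintro h (a | a) <;> rcases a with ⟨a⟩ <;> rfl

/-- Coinduction along a group homomorphism `K → H`, on isomorphism classes. -/
def coinduced {K : Type u} [Group K] [Finite H] (φ : K →* H) : FinGSetClass K → FinGSetClass H :=
  Quotient.map (FinGSet.coinduced φ) fun _ _ h => coinduced_congr φ h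

/-- The number of fixed points of a subgroup. -/
noncomputable def mark (I : Subgroup H) : FinGSetClass H →+* ℕ where
  toFun := Quotient.lift (fun X : FinGSet H => Nat.card (MulAction.fixedPoints I X)) (by
    rintro X Y ⟨e, he⟩
    refine Nat.card_congr (e.subtypeEquiv fun x => forall_congr' fun i => ?_)
    show (i : H) • x = x ↔ (i : H) • e x = e x
    rw [← he, e.apply_eq_iff_eq])
  map_zero' := by
    have : IsEmpty (MulAction.fixedPoints I (FinGSet.empty H)) := ⟨fun x => PEmpty.elim x.1⟩
    exact Nat.card_of_isEmpty
  map_one' := by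
    have : Unique (MulAction.fixedPoints I (FinGSet.point H)) :=
      { default := ⟨PUnit.unit, fun _ => rfl⟩
        uniq := fun _ => rfl }
    exact Nat.card_unique
  map_add' := by
    rintro ⟨X⟩ ⟨Y⟩
    refine Eq.trans (Nat.card_congr ?_) (Nat.card_sum (α := MulAction.fixedPoints I X)
      (β := MulAction.fixedPoints I Y))
    refine
      { toFun := fun z => match z with
          | ⟨Sum.inl x, hx⟩ => Sum.inl ⟨x, fun i => Sum.inl_injective (hx i)⟩
          | ⟨Sum.inr x, hx⟩ => Sum.inr ⟨x, fun i => Sum.inr_injective (hx i)⟩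
        invFun := fun z => match z with
          | Sum.inl x => ⟨Sum.inl x.1, fun i => congrArg Sum.inl (x.2 i)⟩
          | Sum.inr x => ⟨Sum.inr x.1, fun i => congrArg Sum.inr (x.2 i)⟩
        left_inv := ?_
        right_inv := ?_ }
    · rintro ⟨x | x, hx⟩ <;> rfl
    · rintro (x | x) <;> rfl
  map_mul' := by
    rintro ⟨X⟩ ⟨Y⟩
    refine Eq.trans (Nat.card_congr ?_) (Nat.card_prod (MulAction.fixedPoints I X)
      (MulAction.fixedPoints I Y))
    exact
      { toFun := fun z => (⟨z.1.1, fun i => congrArg Prod.fst (z.2 i)⟩,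
          ⟨z.1.2, fun i => congrArg Prod.snd (z.2 i)⟩)
        invFun := fun z => ⟨(z.1.1, z.2.1), fun i => Prod.ext (z.1.2 i) (z.2.2 i)⟩
        left_inv := fun _ => rfl
        right_inv := fun _ => rfl }

end Basic

end FinGSetClass

/-! ### The norm of a formal difference

On isomorphism classes, coinduction from `K` to `H` is polynomial of degree at most `|H|`
(in fact of degree `[H : K]` for a subgroup `K`); it is extended to formal differences by
`GrothendieckRing.extend`. -/

namespace FinGSetClass

section Polynomial

open FinGSet Finset

variable {H : Type u} [Group H]

/-- A finite `H`-set with an invariant labelling is the sum of the parts with a given label. -/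
theorem mk_eq_sum_fibers (Z : FinGSet H) {T : Type*} [Fintype T] (c : Z → T)
    (hc : ∀ (h : H) (z : Z), c (h • z) = c z) :
    mk Z = ∑ t : T, mk (Z.sub (fun z => c z = t) fun h z hz => (hc h z).trans hz) := by
  classical
  have key (s : Finset T) :
      mk (Z.sub (fun z => c z ∈ s) fun h z hz => (hc h z).symm ▸ hz) =
        ∑ t ∈ s, mk (Z.sub (fun z => c z = t) fun h z hz => (hc h z).trans hz) := by
    induction s using Finset.induction_on with
    | empty =>
      have : IsEmpty (Z.sub (fun z => c z ∈ (∅ : Finset T)) fun h z hz => (hc h z).symm ▸ hz) :=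
        ⟨fun z => Finset.notMem_empty _ z.2⟩
      exact mk_empty _
    | insert a s ha ih =>
      rw [Finset.sum_insert ha, ← ih, mk_add]
      refine Eq.symm (mk_eq_mk.mpr ⟨Equiv.ofBijective
        (Sum.elim (fun z => ⟨z.1, Finset.mem_insert.mpr (Or.inl z.2)⟩)
          (fun z => ⟨z.1, Finset.mem_insert.mpr (Or.inr z.2)⟩)) ⟨?_, ?_⟩, ?_⟩)
      · rintro (x | x) (y | y) hxy
        · have e : x.1 = y.1 := congrArg (Subtype.val (p := fun z => c z ∈ insert a s)) hxy
          exact congrArg Sum.inl (Subtype.ext e)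
        · have e : x.1 = y.1 := congrArg Subtype.val hxy
          exact (ha (x.2 ▸ e ▸ y.2)).elim
        · have e : x.1 = y.1 := congrArg Subtype.val hxy
          exact (ha (y.2 ▸ e ▸ x.2)).elim
        · have e : x.1 = y.1 := congrArg (Subtype.val (p := fun z => c z ∈ insert a s)) hxy
          exact congrArg Sum.inr (Subtype.ext e)
      · rintro ⟨z, hz⟩
        rcases Finset.mem_insert.mp hz with h | h
        · exact ⟨Sum.inl ⟨z, h⟩, rfl⟩
        · exact ⟨Sum.inr ⟨z, h⟩, rfl⟩
      · rintro h (x | x) <;> rfl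
  rw [← key Finset.univ]
  exact mk_eq_mk.mpr ⟨(Equiv.subtypeUnivEquiv fun _ => Finset.mem_univ _).symm, fun _ _ => rfl⟩

theorem nsmul_mk (Y : FinGSet H) (i : ℕ) : i • mk Y = mk (copies (Fin i) Y) := by
  induction i with
  | zero =>
    have : IsEmpty (copies (Fin 0) Y) := ⟨fun z => z.1.elim0⟩
    rw [zero_nsmul, mk_empty]
  | succ i ih =>
    rw [succ_nsmul, ih, mk_add]
    refine mk_eq_mk.mpr ⟨Equiv.ofBijective
      (Sum.elim (fun z => (Fin.castSucc z.1, z.2)) (fun y => (Fin.last i, y))) ⟨?_, ?_⟩, ?_⟩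
    · rintro (⟨a, x⟩ | x) (⟨b, y⟩ | y) hxy
      · have h := Prod.ext_iff.mp hxy
        exact congrArg Sum.inl (Prod.ext (Fin.castSucc_injective i h.1) h.2)
      · exact ((Fin.castSucc_lt_last a).ne (Prod.ext_iff.mp hxy).1).elim
      · exact ((Fin.castSucc_lt_last b).ne' (Prod.ext_iff.mp hxy).1).elim
      · exact congrArg Sum.inr (Prod.ext_iff.mp hxy).2
    · rintro ⟨a, x⟩
      induction a using Fin.lastCases with
      | last => exact ⟨Sum.inr x, rfl⟩
      | cast a => exact ⟨Sum.inl (a, x), rfl⟩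
    · rintro h (x | x) <;> rfl

variable {K : Type u} [Group K] [Finite H]

/-- The labels in `S` which are used by an element of `Map_K(H, X ⊔ S × Y)`. -/
noncomputable def used (φ : K →* H) (X Y : FinGSet K) (S : Type) [Fintype S]
    (f : FinGSet.coinduced φ (disjUnion X (copies S Y))) : Finset S :=
  letI := Classical.decPred fun s : S => ∃ (h : H) (y : Y), f.1 h = Sum.inr (s, y)
  Finset.univ.filter fun s => ∃ (h : H) (y : Y), f.1 h = Sum.inr (s, y)

theorem mem_used (φ : K →* H) (X Y : FinGSet K) (S : Type) [Fintype S]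
    (f : FinGSet.coinduced φ (disjUnion X (copies S Y))) (s : S) :
    s ∈ used φ X Y S f ↔ ∃ (h : H) (y : Y), f.1 h = Sum.inr (s, y) := by
  simp [used]

theorem used_smul (φ : K →* H) (X Y : FinGSet K) (S : Type) [Fintype S] (g : H)
    (f : FinGSet.coinduced φ (disjUnion X (copies S Y))) :
    used φ X Y S (g • f) = used φ X Y S f := by
  ext s
  rw [mem_used, mem_used]
  constructor
  · rintro ⟨h, y, e⟩
    exact ⟨h * g, y, e⟩
  · rintro ⟨h, y, e⟩
    refine ⟨h * g⁻¹, y, Eq.trans ?_ e⟩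
    show f.1 (h * g⁻¹ * g) = f.1 h
    rw [inv_mul_cancel_right]

theorem card_used_le (φ : K →* H) (X Y : FinGSet K) (S : Type) [Fintype S]
    (f : FinGSet.coinduced φ (disjUnion X (copies S Y))) :
    (used φ X Y S f).card ≤ Nat.card H := by
  have hs (s : used φ X Y S f) := (mem_used φ X Y S f s.1).mp s.2
  choose p y hp using hs
  have hinj : Function.Injective p := by
    intro s t hst
    have h := (hp s).symm.trans ((congrArg f.1 hst).trans (hp t))
    exact Subtype.ext (Prod.ext_iff.mp (Sum.inr_injective h)).1
  have := Nat.card_le_card_of_injective p hinj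
  simpa using this

/-- The part of `Map_K(H, X ⊔ S × Y)` where the set of labels which are used is `J`. -/
noncomputable def part (φ : K →* H) (X Y : FinGSet K) (S : Type) [Fintype S]
    (J : Finset S) : FinGSet H :=
  (FinGSet.coinduced φ (disjUnion X (copies S Y))).sub (fun f => used φ X Y S f = J)
    fun h f hf => (used_smul φ X Y S h f).trans hf

theorem part_iso (φ : K →* H) (X Y : FinGSet K) (S T : Type) [Fintype S] [Fintype T]
    (ι : T ↪ S) : mk (part φ X Y T Finset.univ) = mk (part φ X Y S (Finset.univ.map ι)) := by
  let r : disjUnion X (copies T Y) → disjUnion X (copies S Y) :=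
    Sum.map id (Prod.map ι id)
  have hr : Function.Injective r :=
    Function.Injective.sumMap Function.injective_id
      (Function.Injective.prodMap ι.injective Function.injective_id)
  have hrk (k : K) (z : disjUnion X (copies T Y)) : r (k • z) = k • r z := by
    rcases z with z | z <;> rfl
  let F : FinGSet.coinduced φ (disjUnion X (copies T Y)) →
      FinGSet.coinduced φ (disjUnion X (copies S Y)) :=
    fun f => ⟨fun h => r (f.1 h), fun k h => (congrArg r (f.2 k h)).trans (hrk k (f.1 h))⟩
  have hF : Function.Injective F := by
    intro f g hfg
    exact Subtype.ext (funext fun h => hr (congrFun (congrArg Subtype.val hfg) h))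
  have hused (f : FinGSet.coinduced φ (disjUnion X (copies T Y))) :
      used φ X Y S (F f) = (used φ X Y T f).map ι := by
    ext s
    rw [mem_used, Finset.mem_map]
    constructor
    · rintro ⟨h, y, e⟩
      have e' : r (f.1 h) = Sum.inr (s, y) := e
      rcases hfh : f.1 h with x | ⟨t, y'⟩
      · rw [hfh] at e'
        exact (Sum.inl_ne_inr e').elim
      · rw [hfh] at e'
        exact ⟨t, (mem_used φ X Y T f t).mpr ⟨h, y', hfh⟩,
          (Prod.ext_iff.mp (Sum.inr_injective e')).1⟩
    · rintro ⟨t, ht, rfl⟩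
      obtain ⟨h, y, e⟩ := (mem_used φ X Y T f t).mp ht
      refine ⟨h, y, ?_⟩
      show r (f.1 h) = _
      rw [e]
      rfl
  refine mk_eq_mk.mpr ⟨Equiv.ofBijective
    (fun f => ⟨F f.1, (hused f.1).trans (congrArg (Finset.map ι) f.2)⟩) ⟨?_, ?_⟩, ?_⟩
  · intro f g hfg
    exact Subtype.ext (hF (congrArg Subtype.val hfg))
  · rintro ⟨g, hg⟩
    have hex (h : H) : ∃ z, r z = g.1 h := by
      rcases hgh : g.1 h with x | ⟨s, y⟩
      · exact ⟨Sum.inl x, rfl⟩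
      · have hs : s ∈ Finset.univ.map ι := hg ▸ (mem_used φ X Y S g s).mpr ⟨h, y, hgh⟩
        obtain ⟨t, -, rfl⟩ := Finset.mem_map.mp hs
        exact ⟨Sum.inr (t, y), rfl⟩
    choose f hf using hex
    have hfk (k : K) (h : H) : f (φ k * h) = k • f h :=
      hr (by rw [hf, hrk, hf, g.2])
    have hFg : F ⟨f, hfk⟩ = g := Subtype.ext (funext hf)
    refine ⟨⟨⟨f, hfk⟩, ?_⟩, Subtype.ext hFg⟩
    refine Finset.map_injective ι ?_
    exact (hused _).symm.trans ((congrArg (used φ X Y S) hFg).trans hg)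
  · intro h f
    rfl

theorem coinduced_add_nsmul (φ : K →* H) (X Y : FinGSet K) (i : ℕ) :
    coinduced φ (mk X + i • mk Y) =
      ∑ j ∈ range (Nat.card H + 1), i.choose j • mk (part φ X Y (Fin j) Finset.univ) := by
  classical
  have h0 (j : ℕ) (hj : j ∉ range (Nat.card H + 1)) :
      i.choose j • mk (part φ X Y (Fin j) Finset.univ) = 0 := by
    have : IsEmpty (part φ X Y (Fin j) Finset.univ) := by
      refine ⟨fun f => hj ?_⟩
      have h := card_used_le φ X Y (Fin j) f.1
      rw [f.2, Finset.card_univ, Fintype.card_fin] at h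
      exact mem_range.mpr (Nat.lt_succ_of_le h)
    rw [mk_empty, smul_zero]
  have h1 (j : ℕ) (hj : j ∉ range (i + 1)) :
      i.choose j • mk (part φ X Y (Fin j) Finset.univ) = 0 := by
    rw [Nat.choose_eq_zero_of_lt (by simpa using hj), zero_smul]
  have h2 : ∑ j ∈ range (Nat.card H + 1), i.choose j • mk (part φ X Y (Fin j) Finset.univ) =
      ∑ j ∈ range (i + 1), i.choose j • mk (part φ X Y (Fin j) Finset.univ) := by
    rw [Finset.sum_subset (subset_union_left (s₂ := range (i + 1))) fun j _ hj => h0 j hj,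
      Finset.sum_subset (subset_union_right (s₁ := range (Nat.card H + 1))) fun j _ hj => h1 j hj]
  rw [h2, nsmul_mk, mk_add]
  show mk (FinGSet.coinduced φ (disjUnion X (copies (Fin i) Y))) = _
  rw [mk_eq_sum_fibers _ (used φ X Y (Fin i)) (used_smul φ X Y (Fin i))]
  have h3 (J : Finset (Fin i)) : mk (part φ X Y (Fin i) J) =
      mk (part φ X Y (Fin J.card) Finset.univ) := by
    rw [part_iso φ X Y (Fin i) (Fin J.card) (J.orderEmbOfFin rfl).toEmbedding,
      Finset.map_orderEmbOfFin_univ]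
  refine (Finset.sum_congr rfl fun J _ => h3 J).trans ?_
  rw [← Finset.powerset_univ,
    Finset.sum_powerset_apply_card (fun j => mk (part φ X Y (Fin j) Finset.univ))]
  simp

/-- Coinduction is a polynomial map. -/
theorem coinduced_isPolynomial (φ : K →* H) :
    GrothendieckRing.IsPolynomial (Nat.card H)
      (fun x : FinGSetClass K => GrothendieckRing.of (coinduced φ x)) := by
  intro y
  funext x
  rcases x with ⟨X⟩
  rcases y with ⟨Y⟩
  show (fwdDiff (mk Y))^[Nat.card H + 1] _ (mk X) = 0
  rw [fwdDiff_iter_eq_sum_shift]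
  simp only [coinduced_add_nsmul, map_sum, map_nsmul, Finset.smul_sum]
  rw [Finset.sum_comm]
  refine Finset.sum_eq_zero fun j hj => ?_
  have h := fwdDiff_iter_choose_zero j (Nat.card H + 1)
  rw [fwdDiff_iter_eq_sum_shift, if_neg (by have := mem_range.mp hj; omega)] at h
  simp only [← natCast_zsmul, smul_smul, ← Finset.sum_smul]
  simp only [smul_eq_mul, mul_one, zero_add] at h
  rw [h, zero_smul]

end Polynomial

end FinGSetClass

/-! ### The Burnside ring -/

/-- The Burnside ring `A(H)`: formal differences of isomorphism classes of finite `H`-sets, with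
disjoint union as addition and Cartesian product as multiplication. -/
abbrev BurnsideRing (H : Type u) [Group H] : Type (u + 1) :=
  GrothendieckRing (FinGSetClass H)

namespace BurnsideRing

variable {H K : Type u} [Group H] [Group K]

/-- The class of a finite `H`-set in the Burnside ring. -/
noncomputable def ofSet (X : FinGSet H) : BurnsideRing H := GrothendieckRing.of (FinGSetClass.mk X)

/-- Restriction along a group homomorphism `K → H`. -/
noncomputable def restrict (φ : K →* H) : BurnsideRing H →+* BurnsideRing K :=
  GrothendieckRing.lift (GrothendieckRing.of.comp (FinGSetClass.restrict φ))

/-- The additive extension of `X ↦ H ×_K X` to formal differences. -/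
noncomputable def induced [Finite H] (φ : K →* H) : BurnsideRing K →+ BurnsideRing H :=
  GrothendieckRing.liftAdd (GrothendieckRing.ofAdd.comp (FinGSetClass.induced φ))

/-- The polynomial extension of `X ↦ Map_K(H, X)` to formal differences. -/
noncomputable def coinduced [Finite H] (φ : K →* H) : BurnsideRing K → BurnsideRing H :=
  GrothendieckRing.extend (Nat.card H) (fun x => GrothendieckRing.of (FinGSetClass.coinduced φ x))
    (FinGSetClass.coinduced_isPolynomial φ)

/-- The mark of the subgroup `I`: the ring homomorphism `A(H) → ℤ` with `X ↦ |X^I|`. -/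
noncomputable def mark (I : Subgroup H) : BurnsideRing H →+* ℤ :=
  GrothendieckRing.lift ((Nat.castRingHom ℤ).comp (FinGSetClass.mark I))

/-- The mark of the subgroup `I` modulo `p`; for `p = 0` the target `ZMod 0` is `ℤ`. -/
noncomputable def markMod (p : ℕ) (I : Subgroup H) : BurnsideRing H →+* ZMod p :=
  (Int.castRingHom (ZMod p)).comp (mark I)

theorem restrict_ofSet (φ : K →* H) (X : FinGSet H) :
    restrict φ (ofSet X) = ofSet (X.restrict φ) :=
  GrothendieckRing.lift_of _ _

theorem induced_ofSet [Finite H] (φ : K →* H) (X : FinGSet K) :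
    induced φ (ofSet X) = ofSet (X.induced φ) :=
  GrothendieckRing.liftAdd_ofAdd (GrothendieckRing.ofAdd.comp (FinGSetClass.induced φ))
    (FinGSetClass.mk X)

theorem coinduced_ofSet [Finite H] (φ : K →* H) (X : FinGSet K) :
    coinduced φ (ofSet X) = ofSet (X.coinduced φ) :=
  GrothendieckRing.extend_of _ _ _ _

theorem mark_ofSet (I : Subgroup H) (X : FinGSet H) :
    mark I (ofSet X) = Nat.card (MulAction.fixedPoints I X) :=
  GrothendieckRing.lift_of _ _

end BurnsideRing

/-! ### The Burnside Tambara functor, its ideals and its spectrum -/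

namespace BurnsideTambara

variable {G : Type u} [Group G]

/-- The value `A_G(G/H) = A(H)`. -/
abbrev obj (H : Subgroup G) : Type (u + 1) := BurnsideRing H

/-- The conjugate `H^g = g⁻¹ H g`. -/
def conjSubgroup (H : Subgroup G) (g : G) : Subgroup G := H.comap (MulAut.conj g).toMonoidHom

theorem mem_conjSubgroup {H : Subgroup G} {g x : G} :
    x ∈ conjSubgroup H g ↔ g * x * g⁻¹ ∈ H := Iff.rfl

/-- The homomorphism `H^g → H`, `x ↦ g x g⁻¹`. -/
def conjHom (H : Subgroup G) (g : G) : conjSubgroup H g →* H where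
  toFun x := ⟨g * x * g⁻¹, x.2⟩
  map_one' := by simp
  map_mul' x y := by
    apply Subtype.ext
    simp [mul_assoc]

/-- Restriction from `H` to `K`. -/
noncomputable def res {K H : Subgroup G} (h : K ≤ H) : obj H →+* obj K :=
  BurnsideRing.restrict (Subgroup.inclusion h)

/-- Conjugation `A(H) → A(H^g)`: `x` in `H^g` acts on `X^g = X` as `g x g⁻¹`. -/
noncomputable def conj (H : Subgroup G) (g : G) : obj H →+* obj (conjSubgroup H g) :=
  BurnsideRing.restrict (conjHom H g)

/-- Transfer from `K` to `H`: `X ↦ H ×_K X`. -/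
noncomputable def tr [Finite G] {K H : Subgroup G} (h : K ≤ H) : obj K →+ obj H :=
  BurnsideRing.induced (Subgroup.inclusion h)

/-- Norm from `K` to `H`: `X ↦ Map_K(H, X)`. -/
noncomputable def norm [Finite G] {K H : Subgroup G} (h : K ≤ H) : obj K → obj H :=
  BurnsideRing.coinduced (Subgroup.inclusion h)

variable (G) in
/-- A family of ring ideals, one in each `A_G(G/H)`, ordered by levelwise inclusion. -/
abbrev IdealFamily : Type (u + 1) := ∀ H : Subgroup G, Ideal (obj H)

/-- The conditions for a family of ring ideals to be an ideal of the Tambara functor. -/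
structure IsTambaraIdeal [Finite G] (I : IdealFamily G) : Prop where
  res_mem : ∀ ⦃K H : Subgroup G⦄ (h : K ≤ H) (x : obj H), x ∈ I H → res h x ∈ I K
  tr_mem : ∀ ⦃K H : Subgroup G⦄ (h : K ≤ H) (x : obj K), x ∈ I K → tr h x ∈ I H
  norm_mem : ∀ ⦃K H : Subgroup G⦄ (h : K ≤ H) (x : obj K), x ∈ I K →
    ∃ y ∈ I H, norm h x = y + norm h 0
  conj_mem : ∀ (H : Subgroup G) (g : G) (x : obj H), x ∈ I H → conj H g x ∈ I (conjSubgroup H g)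

/-- The value at `G/H` of the product of two ideals: the elements `f_+ (a b)`, where
`f : A → G/H` is a map of finite `G`-sets and `a`, `b` are in the values of the ideals at `A`.
Here `A` is written as a disjoint union of orbits `G/K i`, on which `f` is given by elements `g i`
of `G`, as `x (K i) ↦ x (g i) H`, with `(K i)^(g i) ≤ H`; then `f_+` is the sum of the maps
`tr ∘ conj` over the orbits. -/
def mulSet [Finite G] (I J : IdealFamily G) (H : Subgroup G) : Set (obj H) :=
  {x | ∃ (n : ℕ) (K : Fin n → Subgroup G) (g : Fin n → G)
    (h : ∀ i, conjSubgroup (K i) (g i) ≤ H) (a b : ∀ i, obj (K i)),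
    (∀ i, a i ∈ I (K i)) ∧ (∀ i, b i ∈ J (K i)) ∧
      x = ∑ i, tr (h i) (conj (K i) (g i) (a i * b i))}

/-- Prime ideals of the Burnside Tambara functor. As for rings, the whole functor is not prime. -/
structure IsPrime [Finite G] (P : IdealFamily G) : Prop where
  isTambaraIdeal : IsTambaraIdeal P
  proper : P ≠ ⊤
  le_or_le : ∀ I J : IdealFamily G, IsTambaraIdeal I → IsTambaraIdeal J →
    (∀ H, mulSet I J H ⊆ P H) → I ≤ P ∨ J ≤ P

variable (G) in
/-- The prime spectrum of the Burnside Tambara functor, as a set of families of ideals. -/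
def spec [Finite G] : Set (IdealFamily G) := {P | IsPrime P}

/-- `I` is subconjugate to `C` in `G`: some conjugate `I^g` is contained in `C`. -/
def Subconj (I C : Subgroup G) : Prop := ∃ g : G, conjSubgroup I g ≤ C

/-- The family `p_{C,p}`: its value at `G/H` is the intersection of the kernels of the marks modulo
`p` of those subgroups of `H` which are subconjugate to `C` in `G`. -/
noncomputable def primeFamily (C : Subgroup G) (p : ℕ) : IdealFamily G := fun H =>
  ⨅ (I : Subgroup H) (_ : Subconj (I.map H.subtype) C), RingHom.ker (BurnsideRing.markMod p I)

end BurnsideTambara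

/-! A cyclic group is abelian, so conjugation fixes every subgroup and everything can be computed on
marks. For $K\le H$ the mark at $I\le H$ of a transfer is $[H:K]\,\varphi^I(x)$ if $I\le K$ and $0$
otherwise; the mark of a norm is $\varphi^{I\cap K}(x)^{[H:IK]}$ (`mark_induced`,
`mark_induced_eq_zero`, `mark_coinduced`). Hence, for every set $S$ of subgroups closed under
passing to subgroups, the elements whose marks at the members of $S$ are divisible by $n$ form a
Tambara ideal `markFamily S n`; the family $\mathfrak p_{C,p}$ is the case $S=\{I\le C\}$.

These are prime: if an ideal is not contained in $\mathfrak p_{C,p}$, then restricting a bad element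
to the bad subgroup $D\le C$ and taking the norm up to $C$ gives an element at $G/C$ whose mark at
$C$ is not divisible by $p$ (`exists_not_dvd_mark_top`). Two such elements have a product of the
same kind.

Conversely, let $P$ be prime. Choose a prime $p$ with `markFamily Set.univ p ≤ P` if there is one,
and $p=0$ otherwise. A minimal $S$ with `markFamily S p ≤ P` consists of all subgroups of a single
$C$, by primality. If $P\not\subseteq\mathfrak p_{C,p}$, some $y\in P(G/C)$ has $\varphi^C(y)$ not
divisible by $p$. Norms of $y$ show that a power of $\varphi^C(y)$ multiplies the ideal of the
proper subgroups of $C$ into $P$ (`pow_smul_mem`). For $p$ prime this power is invertible modulo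
$p$, against minimality. For $p=0$, primality puts into $P$ either that ideal or some `markFamily
Set.univ n` with $n\ne0$; in the latter case a prime factor of $n$ contradicts the choice of $p$. -/

namespace GrothendieckRing

/-! ### Newton series: naturality, and the value on powers -/

section Newton

variable {M N B B' : Type*} [AddCommMonoid M] [AddCommMonoid N] [AddCommGroup B] [AddCommGroup B']

theorem fwdDiff_iterate_comp_addMonoidHom (f : N → B) (φ : M →+ N) (y : M) (j : ℕ) :
    (fwdDiff y)^[j] (f ∘ φ) = (fwdDiff (φ y))^[j] f ∘ φ := by
  induction j generalizing f with
  | zero => rfl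
  | succ j ih =>
    have h : fwdDiff y (f ∘ φ) = fwdDiff (φ y) f ∘ φ := by
      funext x
      simp [fwdDiff]
    rw [Function.iterate_succ_apply, h, ih, Function.iterate_succ_apply]

theorem newton_comp_addMonoidHom (n : ℕ) (f : N → B) (φ : M →+ N) (x y : M) :
    newton n (f ∘ φ) x y = newton n f (φ x) (φ y) := by
  simp only [newton, fwdDiff_iterate_comp_addMonoidHom, Function.comp_apply]

theorem map_newton (n : ℕ) (f : M → B) (φ : B →+ B') (x y : M) :
    φ (newton n f x y) = newton n (φ ∘ f) x y := by
  simp only [newton, map_sum, map_zsmul]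
  refine Finset.sum_congr rfl fun j _ => ?_
  simp only [fwdDiff_iter_eq_sum_shift, map_sum, map_zsmul, Function.comp_apply]

theorem isPolynomial_pow {m n : ℕ} (h : m ≤ n) : IsPolynomial n (fun t : ℤ => t ^ m) := by
  intro y
  funext x
  rw [fwdDiff_iter_eq_sum_shift]
  -- Along the direction $y$ the function is $k\mapsto (x+ky)^m$, a polynomial in $k$ of degree at
  -- most $m$; differences with step $y$ become differences with step $1$ at $k=0$.
  have hdeg : ((Polynomial.C x + Polynomial.C y * Polynomial.X : Polynomial ℤ) ^ m).natDegree <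
      n + 1 := by
    refine Nat.lt_succ_of_le ((Polynomial.natDegree_pow_le_of_le (m := 1) m ?_).trans (by simpa))
    compute_degree
  have h2 := congrFun (Polynomial.fwdDiff_iter_eq_zero_of_degree_lt hdeg) 0
  rw [fwdDiff_iter_eq_sum_shift] at h2
  simpa [mul_comm y] using h2

/-- In $\mathbb Z$ the difference $a-b$ is itself a point, so invariance under a common shift by $b$
reduces the series at $(a,b)$ to the one at $(a-b,0)$. -/
theorem newton_pow {m n : ℕ} (h : m ≤ n) (a b : ℤ) :
    newton n (fun t : ℤ => t ^ m) a b = (a - b) ^ m := by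
  have h1 := newton_add_right (isPolynomial_pow h) (a - b) 0 b
  rw [newton_zero, sub_add_cancel, zero_add] at h1
  exact h1

end Newton

end GrothendieckRing

/-! ### Marks of restrictions -/

namespace BurnsideRing

variable {H K : Type u} [Group H] [Group K]

theorem addMonoidHom_ext {B : Type*} [AddCommGroup B] {f g : BurnsideRing H →+ B}
    (h : ∀ X : FinGSet H, f (ofSet X) = g (ofSet X)) : f = g := by
  refine GrothendieckRing.addHom_ext ?_
  rintro ⟨X⟩
  exact h X

theorem ofSet_eq {X Y : FinGSet H} (h : FinGSet.Iso X Y) : ofSet X = ofSet Y :=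
  congrArg GrothendieckRing.of (FinGSetClass.mk_eq_mk.mpr h)

theorem mark_restrict (φ : K →* H) (I : Subgroup K) (x : BurnsideRing H) :
    mark I (restrict φ x) = mark (I.map φ) x := by
  refine DFunLike.congr_fun (f := ((mark I).comp (restrict φ) : BurnsideRing H →+ ℤ))
    (g := (mark (I.map φ) : BurnsideRing H →+ ℤ)) (addMonoidHom_ext fun X => ?_) x
  show mark I (restrict φ (ofSet X)) = mark (I.map φ) (ofSet X)
  rw [restrict_ofSet, mark_ofSet, mark_ofSet]
  refine congrArg _ (Nat.card_congr (Equiv.subtypeEquivRight fun x => ?_))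
  constructor
  · rintro h ⟨_, k, hk, rfl⟩
    exact h ⟨k, hk⟩
  · intro h k
    exact h ⟨φ k, k, k.2, rfl⟩

end BurnsideRing

/-! ### Marks of transfers and norms over an abelian group -/

namespace BurnsideRing

section Comm

variable {H K : Type u} [CommGroup H] [Group K]

/-- For an abelian group `H`, the fixed points of `H ×_K X` under a subgroup `I ≤ K` are
`H/K × X^I`. -/
theorem card_fixedPoints_induced [Finite H] {φ : K →* H} (hφ : Function.Injective φ)
    {I : Subgroup H} (hI : I ≤ φ.range) (X : FinGSet K) :
    Nat.card (MulAction.fixedPoints I (X.induced φ)) =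
      φ.range.index * Nat.card (MulAction.fixedPoints (I.comap φ) X) := by
  rw [Subgroup.index, ← Nat.card_prod]
  let s := FinGSet.inducedSetoid φ X
  let π : H × X → X.induced φ := Quotient.mk s
  -- In an abelian group $ih=h\varphi(k)$ just says $\varphi(k)=i$, so the stabilizer of $[h,x]$
  -- does not depend on $h$.
  have hfix (h : H) (x : X) (i : I) :
      i • π (h, x) = π (h, x) ↔ ∃ k : K, φ k = i ∧ k • x = x := by
    refine Iff.trans (Quotient.eq (r := s) (x := ((i : H) * h, x)) (y := (h, x))) ?_
    refine exists_congr fun k => ?_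
    show (i : H) * h = h * φ k ∧ x = k • x ↔ _
    rw [mul_comm, mul_left_cancel_iff, eq_comm, eq_comm (a := x)]
  refine (Nat.card_congr (Equiv.ofBijective (fun z : (H ⧸ φ.range) ×
    MulAction.fixedPoints (I.comap φ) X => (⟨π (z.1.out, z.2.1), fun i => ?_⟩ :
      MulAction.fixedPoints I (X.induced φ))) ⟨?_, ?_⟩)).symm
  · obtain ⟨k, hk⟩ := hI i.2
    exact (hfix _ _ i).mpr ⟨k, hk, z.2.2 ⟨k, by simp [hk]⟩⟩
  · rintro ⟨a, x⟩ ⟨b, y⟩ hab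
    obtain ⟨k, h1, h2⟩ : s (a.out, x.1) (b.out, y.1) :=
      Quotient.exact (congrArg Subtype.val hab)
    change a.out = b.out * φ k at h1
    change y.1 = k • x.1 at h2
    have hab' : a = b := by
      rw [← a.out_eq', ← b.out_eq', eq_comm]
      refine QuotientGroup.eq.mpr ⟨k, ?_⟩
      rw [h1, inv_mul_cancel_left]
    subst hab'
    have hk : k = 1 := hφ (by simpa using h1)
    subst hk
    exact Prod.ext rfl (Subtype.ext (by simpa using h2.symm))
  · rintro ⟨z, hz⟩
    obtain ⟨⟨h, x⟩, rfl⟩ := Quotient.exists_rep z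
    obtain ⟨k, hk⟩ : ((h : H ⧸ φ.range).out)⁻¹ * h ∈ φ.range :=
      QuotientGroup.eq.mp (QuotientGroup.out_eq' _)
    refine ⟨((h : H ⧸ φ.range), ⟨k • x, ?_⟩), Subtype.ext (Quotient.sound ?_)⟩
    · rintro ⟨l, hl⟩
      obtain ⟨l', hl', hx⟩ := (hfix h x ⟨φ l, hl⟩).mp (hz ⟨φ l, hl⟩)
      obtain rfl := hφ hl'
      show l' • k • x = k • x
      rw [smul_smul, show l' * k = k * l' from hφ (by simp [mul_comm]), mul_smul, hx]
    · exact ⟨k⁻¹, by simp [hk], by simp⟩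

theorem isEmpty_fixedPoints_induced [Finite H] {φ : K →* H} {I : Subgroup H}
    (hI : ¬ I ≤ φ.range) (X : FinGSet K) : IsEmpty (MulAction.fixedPoints I (X.induced φ)) := by
  refine ⟨fun ⟨z, hz⟩ => hI fun i hi => ?_⟩
  obtain ⟨⟨h, x⟩, rfl⟩ := Quotient.exists_rep z
  obtain ⟨k, h1, -⟩ : FinGSet.inducedSetoid φ X (i * h, x) (h, x) :=
    Quotient.exact (hz ⟨i, hi⟩)
  exact ⟨k, mul_left_cancel (a := h) (h1.symm.trans (mul_comm _ _))⟩

theorem mark_induced [Finite H] {φ : K →* H} (hφ : Function.Injective φ)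
    {I : Subgroup H} (hI : I ≤ φ.range) (x : BurnsideRing K) :
    mark I (induced φ x) = φ.range.index * mark (I.comap φ) x := by
  refine DFunLike.congr_fun (f := (mark I : BurnsideRing H →+ ℤ).comp (induced φ))
    (g := (AddMonoidHom.mulLeft (φ.range.index : ℤ)).comp
      (mark (I.comap φ) : BurnsideRing K →+ ℤ)) (addMonoidHom_ext fun X => ?_) x
  show mark I (induced φ (ofSet X)) = φ.range.index * mark (I.comap φ) (ofSet X)
  rw [induced_ofSet, mark_ofSet, mark_ofSet, card_fixedPoints_induced hφ hI, Nat.cast_mul]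

theorem mark_induced_eq_zero [Finite H] {φ : K →* H} {I : Subgroup H} (hI : ¬ I ≤ φ.range)
    (x : BurnsideRing K) : mark I (induced φ x) = 0 := by
  refine DFunLike.congr_fun (f := (mark I : BurnsideRing H →+ ℤ).comp (induced φ))
    (g := 0) (addMonoidHom_ext fun X => ?_) x
  show mark I (induced φ (ofSet X)) = 0
  have := isEmpty_fixedPoints_induced hI X
  rw [induced_ofSet, mark_ofSet, Nat.card_of_isEmpty, Nat.cast_zero]

/-- For an abelian group `H`, the fixed points of `Map_K(H, X)` under a subgroup `I` are the maps
`H/IK → X^(I ∩ K)`. -/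
theorem card_fixedPoints_coinduced [Finite H] (φ : K →* H) (I : Subgroup H) (X : FinGSet K) :
    Nat.card (MulAction.fixedPoints I (X.coinduced φ)) =
      Nat.card (MulAction.fixedPoints (I.comap φ) X) ^ (I ⊔ φ.range).index := by
  rw [Subgroup.index, ← Nat.card_fun]
  -- The action translates the argument on the right and equivariance is on the left; by
  -- commutativity a fixed map is constant along $I$ and equivariant along $K$, hence determined by
  -- one value per coset of $I\varphi(K)$.
  have hinv (f : MulAction.fixedPoints I (X.coinduced φ)) (i : H) (hi : i ∈ I) (h : H) :
      f.1.1 (i * h) = f.1.1 h := by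
    rw [mul_comm]
    exact congrFun (congrArg Subtype.val (f.2 ⟨i, hi⟩)) h
  have hrep (h : H) : ∃ (k : K) (i : I), h = φ k * (i * (h : H ⧸ (I ⊔ φ.range)).out) := by
    have h1 : ((h : H ⧸ (I ⊔ φ.range)).out)⁻¹ * h ∈ I ⊔ φ.range :=
      QuotientGroup.eq.mp (QuotientGroup.out_eq' _)
    obtain ⟨i, hi, _, ⟨k, rfl⟩, hik⟩ := Subgroup.mem_sup.mp h1
    rw [eq_inv_mul_iff_mul_eq] at hik
    exact ⟨k, ⟨i, hi⟩, hik.symm.trans ((mul_rotate' _ _ _).trans (mul_left_comm _ _ _))⟩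
  choose κ ι hκ using hrep
  -- Two decompositions of the same element differ by an element of $\varphi^{-1}(I)$, which fixes
  -- the prescribed value; so the chosen `κ` and `ι` do not matter.
  have hwd {k k' : K} {i i' : I} {o : H} (x : MulAction.fixedPoints (I.comap φ) X)
      (h : φ k * (i * o) = φ k' * (i' * o)) : k • x.1 = k' • x.1 := by
    have h1 : φ (k'⁻¹ * k) = i' * (i : H)⁻¹ := by
      rw [map_mul, map_inv, inv_mul_eq_iff_eq_mul, ← mul_assoc, eq_mul_inv_iff_mul_eq]
      exact mul_right_cancel (b := o) (by simpa only [mul_assoc] using h)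
    have h2 := x.2 ⟨k'⁻¹ * k, by
      rw [Subgroup.mem_comap, h1]
      exact I.mul_mem i'.2 (I.inv_mem i.2)⟩
    have h3 : (k'⁻¹ * k) • x.1 = x.1 := h2
    rw [mul_smul, inv_smul_eq_iff] at h3
    exact h3
  refine Nat.card_congr
    { toFun := fun f q => ⟨f.1.1 q.out, fun k => ?_⟩
      invFun := fun v => ⟨⟨fun h => κ h • (v h).1, fun k h => ?_⟩, fun i => ?_⟩
      left_inv := fun f => ?_
      right_inv := fun v => ?_ }
  · show (k : K) • f.1.1 q.out = f.1.1 q.out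
    rw [← f.1.2, hinv f _ k.2]
  · have hq : ((φ k * h : H) : H ⧸ (I ⊔ φ.range)) = h := by
      rw [mul_comm]
      exact QuotientGroup.mk_mul_of_mem h (Subgroup.mem_sup_right ⟨k, rfl⟩)
    show κ (φ k * h) • (v ((φ k * h : H) : H ⧸ (I ⊔ φ.range))).1 = k • κ h • (v h).1
    rw [hq, ← mul_smul]
    refine hwd (i := ι (φ k * h)) (i' := ι h) (o := (h : H ⧸ (I ⊔ φ.range)).out) _ ?_
    have h1 := hκ (φ k * h)
    rw [hq] at h1
    rw [← h1, map_mul, mul_assoc, ← hκ h]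
  · refine Subtype.ext (funext fun h => ?_)
    have hq : ((h * i : H) : H ⧸ (I ⊔ φ.range)) = h :=
      QuotientGroup.mk_mul_of_mem h (Subgroup.mem_sup_left i.2)
    show κ (h * i) • (v ((h * i : H) : H ⧸ (I ⊔ φ.range))).1 = κ h • (v h).1
    rw [hq]
    refine hwd (i := ι (h * i)) (i' := i * ι h) (o := (h : H ⧸ (I ⊔ φ.range)).out) _ ?_
    have h1 := hκ (h * i)
    rw [hq] at h1
    rw [← h1, Subgroup.coe_mul, mul_assoc, mul_left_comm, ← hκ h, mul_comm]
  · refine Subtype.ext (Subtype.ext (funext fun h => ?_))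
    show κ h • f.1.1 _ = f.1.1 h
    conv_rhs => rw [hκ h, f.1.2, hinv f _ (ι h).2]
  · funext q
    refine Subtype.ext ?_
    have hq : ((q.out : H) : H ⧸ (I ⊔ φ.range)) = q := QuotientGroup.out_eq' q
    show κ q.out • (v ((q.out : H) : H ⧸ (I ⊔ φ.range))).1 = (v q).1
    have h1 := hκ q.out
    rw [hq] at h1 ⊢
    have := hwd (k := κ q.out) (k' := 1) (i := ι q.out) (i' := 1) (o := q.out) (v q)
      (by rw [← h1]; simp)
    rw [this, one_smul]

/-- For sets this is the count of fixed points. It passes to formal differences because the Newton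
series defining the norm commutes with additive maps on both sides, and the series of a power is
that power of the difference. -/
theorem mark_coinduced [Finite H] (φ : K →* H) (I : Subgroup H) (x : BurnsideRing K) :
    mark I (coinduced φ x) = mark (I.comap φ) x ^ (I ⊔ φ.range).index := by
  obtain ⟨a, b, hx⟩ := GrothendieckRing.exists_eq_sub x
  have hx' : x = GrothendieckRing.of a - GrothendieckRing.of b := hx
  rw [hx', coinduced, GrothendieckRing.extend_sub, map_sub]
  have h1 := GrothendieckRing.map_newton (Nat.card H)
    (fun x : FinGSetClass K => GrothendieckRing.of (FinGSetClass.coinduced φ x))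
    (mark I : BurnsideRing H →+ ℤ) a b
  have h2 : (mark I : BurnsideRing H →+ ℤ) ∘
      (fun x : FinGSetClass K => GrothendieckRing.of (FinGSetClass.coinduced φ x)) =
      (fun t : ℤ => t ^ (I ⊔ φ.range).index) ∘
        ((mark (I.comap φ) : BurnsideRing K →+ ℤ).comp GrothendieckRing.ofAdd) := by
    funext c
    rcases c with ⟨X⟩
    show mark I (ofSet (X.coinduced φ)) = mark (I.comap φ) (ofSet X) ^ (I ⊔ φ.range).index
    rw [mark_ofSet, mark_ofSet, card_fixedPoints_coinduced, Nat.cast_pow]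
  rw [h2, GrothendieckRing.newton_comp_addMonoidHom, GrothendieckRing.newton_pow] at h1
  · exact h1
  -- The series is cut off at degree $|H|$, so the exponent must not exceed $|H|$.
  · exact Nat.le_of_dvd Nat.card_pos (Subgroup.index_dvd_card _)

end Comm

end BurnsideRing

/-! ### The table of marks and the image in the ghost ring -/

namespace FinGSet

variable {H : Type u} [Group H] [Finite H]

/-- The transitive `H`-set `H/K`. -/
def coset (K : Subgroup H) : FinGSet H where
  carrier := H ⧸ K

end FinGSet

namespace BurnsideRing

section Group

variable {H : Type u} [Group H] [Finite H]

theorem span_range_coset :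
    Submodule.span ℤ (Set.range fun K : Subgroup H => ofSet (FinGSet.coset K)) = ⊤ := by
  classical
  have key (X : FinGSet H) :
      ofSet X ∈ Submodule.span ℤ (Set.range fun K : Subgroup H => ofSet (FinGSet.coset K)) := by
    let T := Quotient (MulAction.orbitRel H X)
    have : Fintype T := Fintype.ofFinite T
    let c : X → T := Quotient.mk (MulAction.orbitRel H X)
    have hc (h : H) (x : X) : c (h • x) = c x := Quotient.sound ⟨h, rfl⟩
    have h1 : ofSet X = ∑ t : T, ofSet (X.sub (fun z => c z = t) fun h z hz => (hc h z).trans hz) :=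
      (congrArg GrothendieckRing.of (FinGSetClass.mk_eq_sum_fibers X c hc)).trans (map_sum _ _ _)
    rw [h1]
    refine Submodule.sum_mem _ fun t _ => Submodule.subset_span ?_
    obtain ⟨x, rfl⟩ := Quotient.exists_rep t
    refine ⟨MulAction.stabilizer H x, ofSet_eq ?_⟩
    let e : FinGSet.coset (MulAction.stabilizer H x) ≃
        X.sub (fun z => c z = c x) fun h z hz => (hc h z).trans hz :=
      (MulAction.orbitEquivQuotientStabilizer H x).symm.trans
        (Equiv.subtypeEquivRight fun z => (Quotient.eq (r := MulAction.orbitRel H X)).symm)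
    have he (h : H) : (e (h : H ⧸ MulAction.stabilizer H x)).1 = h • x :=
      MulAction.orbitEquivQuotientStabilizer_symm_apply H x h
    refine ⟨e, fun h z => ?_⟩
    obtain ⟨k, rfl⟩ := QuotientGroup.mk_surjective z
    refine Subtype.ext ?_
    show (e ((h * k : H) : H ⧸ MulAction.stabilizer H x)).1 = h • (e (k : H ⧸ _)).1
    rw [he, he, mul_smul]
  rw [eq_top_iff]
  rintro x -
  obtain ⟨⟨X⟩, ⟨Y⟩, rfl⟩ := GrothendieckRing.exists_eq_sub x
  exact Submodule.sub_mem _ (key X) (key Y)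

end Group

section Comm

variable {H : Type u} [CommGroup H] [Finite H]

theorem smul_coset_iff {I K : Subgroup H} (i : I) (z : FinGSet.coset K) :
    i • z = z ↔ (i : H) ∈ K := by
  obtain ⟨h, rfl⟩ := QuotientGroup.mk_surjective z
  refine Iff.trans (QuotientGroup.eq (a := (i : H) * h) (b := h)) ?_
  rw [mul_inv_rev, mul_comm h⁻¹, inv_mul_cancel_right, inv_mem_iff]

open Classical in
theorem mark_coset (I K : Subgroup H) :
    mark I (ofSet (FinGSet.coset K)) = if I ≤ K then (K.index : ℤ) else 0 := by
  rw [mark_ofSet]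
  split_ifs with h
  · rw [Subgroup.index]
    exact congrArg _ (Nat.card_congr (Equiv.subtypeUnivEquiv fun z i =>
      (smul_coset_iff i z).mpr (h i.2)))
  · have : IsEmpty (MulAction.fixedPoints I (FinGSet.coset K)) :=
      ⟨fun z => h fun i hi => (smul_coset_iff ⟨i, hi⟩ z.1).mp (z.2 ⟨i, hi⟩)⟩
    rw [Nat.card_of_isEmpty, Nat.cast_zero]

/-- An element of the Burnside ring of an abelian group is determined by its marks. -/
theorem eq_zero_of_mark_eq_zero {x : BurnsideRing H} (hx : ∀ I, mark I x = 0) : x = 0 := by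
  classical
  have : Fintype (Subgroup H) := Fintype.ofFinite _
  have hmem : x ∈ Submodule.span ℤ (Set.range fun K : Subgroup H => ofSet (FinGSet.coset K)) :=
    span_range_coset (H := H) ▸ Submodule.mem_top
  obtain ⟨c, rfl⟩ := (Submodule.mem_span_range_iff_exists_fun ℤ).mp hmem
  -- The table of marks is triangular: at $K$ only the $H/L$ with $L\ge K$ contribute, and
  -- descending induction has already killed $L>K$, leaving $c_K[H:K]=0$.
  have hc (K : Subgroup H) : c K = 0 := by
    induction K using WellFoundedGT.induction with
    | ind K ih =>
      have h := hx K
      rw [map_sum, Finset.sum_eq_single K] at h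
      · rw [map_zsmul, mark_coset, if_pos le_rfl, smul_eq_mul] at h
        exact (mul_eq_zero.mp h).resolve_right (Nat.cast_ne_zero.mpr Subgroup.index_ne_zero_of_finite)
      · intro L _ hL
        rw [map_zsmul, mark_coset]
        split_ifs with hKL
        · rw [ih L (lt_of_le_of_ne hKL hL.symm), zero_smul]
        · rw [smul_zero]
      · exact fun h => (h (Finset.mem_univ _)).elim
  exact Finset.sum_eq_zero fun K _ => by rw [hc K, zero_smul]

-- The element $|L|\cdot[H/L]$ has mark $|L|[H:L]=|H|$ at each subgroup of $L$ and $0$ elsewhere;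
-- subtracting the elements already built for $K<L$ leaves only the mark at $L$.
open Classical in
theorem exists_mark_eq_ite (L : Subgroup H) :
    ∃ e : BurnsideRing H, ∀ I, mark I e = if I = L then (Nat.card H : ℤ) else 0 := by
  induction L using WellFoundedLT.induction with
  | ind L ih =>
    have : Fintype (Subgroup H) := Fintype.ofFinite _
    choose! e he using ih
    refine ⟨(Nat.card L : ℤ) • ofSet (FinGSet.coset L) - ∑ K with K < L, e K, fun I => ?_⟩
    rw [map_sub, map_zsmul, mark_coset, map_sum, Finset.sum_congr rfl fun K hK =>
      he K (Finset.mem_filter.mp hK).2 I, Finset.sum_ite_eq]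
    have hL : (Nat.card L : ℤ) * L.index = Nat.card H := mod_cast L.card_mul_index
    rcases eq_or_ne I L with rfl | hI
    · simp [hL]
    · by_cases hIL : I ≤ L
      · simp [hIL, lt_of_le_of_ne hIL hI, hI, hL]
      · have : ¬ I < L := fun h => hIL h.le
        simp [hIL, this, hI]

/-- The Burnside ring of an abelian group `H` contains all multiples of `|H|` in its ghost ring. -/
theorem exists_eq_nsmul {x : BurnsideRing H} {n : ℕ}
    (hx : ∀ I, ((Nat.card H * n : ℕ) : ℤ) ∣ mark I x) : ∃ y, x = n • y := by
  classical
  have : Fintype (Subgroup H) := Fintype.ofFinite _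
  choose g hg using hx
  choose e he using exists_mark_eq_ite (H := H)
  refine ⟨∑ L, g L • e L, sub_eq_zero.mp (eq_zero_of_mark_eq_zero fun I => ?_)⟩
  simp only [map_sub, map_nsmul, map_sum, map_zsmul, he, hg, smul_eq_mul, mul_ite, mul_zero,
    Finset.sum_ite_eq, Finset.mem_univ, if_true]
  rw [nsmul_eq_mul]
  push_cast
  ring

end Comm

end BurnsideRing

/-! ### Ideals defined by divisibility of marks -/

namespace BurnsideTambara

open BurnsideRing

variable {G : Type u}

section Group

variable [Group G]

/-- The family of the elements whose marks at the subgroups in `S` are divisible by `n`. -/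
noncomputable def markFamily (S : Set (Subgroup G)) (n : ℕ) : IdealFamily G := fun H =>
  ⨅ (I : Subgroup H) (_ : I.map H.subtype ∈ S), RingHom.ker (markMod n I)

/-- Divisibility in $\mathbb Z$ treats all moduli alike: for $n=0$ it means vanishing. -/
theorem mem_markFamily {S : Set (Subgroup G)} {n : ℕ} {H : Subgroup G} {x : obj H} :
    x ∈ markFamily S n H ↔ ∀ I : Subgroup H, I.map H.subtype ∈ S → (n : ℤ) ∣ mark I x := by
  simp only [markFamily, Submodule.mem_iInf, RingHom.mem_ker, markMod, RingHom.comp_apply,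
    eq_intCast, CharP.intCast_eq_zero_iff (ZMod n) n]

theorem mem_markFamily_of_forall_dvd {S : Set (Subgroup G)} {n : ℕ} {H : Subgroup G} {x : obj H}
    (h : ∀ I, (n : ℤ) ∣ mark I x) : x ∈ markFamily S n H :=
  mem_markFamily.mpr fun I _ => h I

variable [Finite G]

theorem mulSet_subset {I J P : IdealFamily G} (hP : IsTambaraIdeal P)
    (h : ∀ H, ∀ a ∈ I H, ∀ b ∈ J H, a * b ∈ P H) (H : Subgroup G) : mulSet I J H ⊆ P H := by
  rintro _ ⟨n, K, g, hK, a, b, ha, hb, rfl⟩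
  exact sum_mem fun i _ => hP.tr_mem _ _ (hP.conj_mem _ _ _ (h _ _ (ha i) _ (hb i)))

theorem IsPrime.le_or_le_of_mul_mem {P I J : IdealFamily G} (hP : IsPrime P)
    (hI : IsTambaraIdeal I) (hJ : IsTambaraIdeal J)
    (h : ∀ H, ∀ a ∈ I H, ∀ b ∈ J H, a * b ∈ P H) : I ≤ P ∨ J ≤ P :=
  hP.le_or_le I J hI hJ (mulSet_subset hP.isTambaraIdeal h)

end Group

variable [CommGroup G]

theorem conjSubgroup_eq (H : Subgroup G) (g : G) : conjSubgroup H g = H := by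
  ext x
  rw [mem_conjSubgroup, mul_comm g, mul_inv_cancel_right]

theorem primeFamily_eq_markFamily (C : Subgroup G) (p : ℕ) :
    primeFamily C p = markFamily (Set.Iic C) p := by
  have h (I : Subgroup G) : Subconj I C ↔ I ∈ Set.Iic C := by
    simp [Subconj, conjSubgroup_eq]
  funext H
  simp only [primeFamily, markFamily, h]

variable [Finite G]

theorem mark_norm {K H : Subgroup G} (h : K ≤ H) (I : Subgroup H) (x : obj K) :
    mark I (norm h x) = mark (I.comap (Subgroup.inclusion h)) x ^
      (I ⊔ (Subgroup.inclusion h).range).index :=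
  mark_coinduced (Subgroup.inclusion h) I x

theorem mark_norm_zero {K H : Subgroup G} (h : K ≤ H) (I : Subgroup H) :
    mark I (norm h (0 : obj K)) = 0 := by
  rw [mark_norm, map_zero, zero_pow Subgroup.index_ne_zero_of_finite]

/-- Each structure map turns a mark at $I$ into a multiple or a positive power of a mark at a
subgroup of $I$, and that subgroup is again in $S$. Positivity of the exponent also makes all marks
of $N(0)$ vanish. -/
theorem isTambaraIdeal_markFamily {S : Set (Subgroup G)} (hS : IsLowerSet S) (n : ℕ) :
    IsTambaraIdeal (markFamily S n) where
  res_mem K H h x hx := by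
    refine mem_markFamily.mpr fun I hI => ?_
    rw [res, mark_restrict]
    refine mem_markFamily.mp hx _ ?_
    rwa [Subgroup.map_map, Subgroup.subtype_comp_inclusion]
  tr_mem K H h x hx := by
    refine mem_markFamily.mpr fun I hI => ?_
    by_cases hIK : I ≤ (Subgroup.inclusion h).range
    · rw [tr, mark_induced (Subgroup.inclusion_injective h) hIK]
      refine Dvd.dvd.mul_left (mem_markFamily.mp hx _ (hS ?_ hI)) _
      rintro _ ⟨k, hk, rfl⟩
      exact ⟨Subgroup.inclusion h k, hk, rfl⟩
    · rw [tr, mark_induced_eq_zero hIK]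
      exact dvd_zero _
  norm_mem K H h x hx := by
    refine ⟨norm h x - norm h 0, mem_markFamily.mpr fun I hI => ?_, (sub_add_cancel _ _).symm⟩
    rw [map_sub, mark_norm_zero, sub_zero, mark_norm]
    refine dvd_pow (mem_markFamily.mp hx _ (hS ?_ hI)) Subgroup.index_ne_zero_of_finite
    rintro _ ⟨k, hk, rfl⟩
    exact ⟨Subgroup.inclusion h k, hk, rfl⟩
  conj_mem H g x hx := by
    refine mem_markFamily.mpr fun I hI => ?_
    rw [conj, mark_restrict]
    refine mem_markFamily.mp hx _ (hS ?_ hI)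
    rintro _ ⟨_, ⟨k, hk, rfl⟩, rfl⟩
    exact ⟨k, hk, by simp [conjHom]⟩

/-- An ideal not contained in `p_{C,n}` has an element at `G/C` that shows this. -/
theorem exists_not_dvd_mark_top {I : IdealFamily G} (hI : IsTambaraIdeal I) {C : Subgroup G}
    {n : ℕ} (h : ¬ I ≤ markFamily (Set.Iic C) n) : ∃ y ∈ I C, ¬ (n : ℤ) ∣ mark ⊤ y := by
  simp only [Pi.le_def, SetLike.le_def, mem_markFamily, not_forall] at h
  obtain ⟨H, x, hx, D, hDC, hD⟩ := h
  replace hDC : D.map H.subtype ≤ C := hDC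
  have hDH : D.map H.subtype ≤ H := Subgroup.map_subtype_le D
  -- The mark of a norm at the whole group $C$ has exponent $[C:C]=1$, so
  -- $\varphi^C(N_D^C\,\mathrm{res}^H_D x)=\varphi^D(x)$; the correction $N(0)$ has mark $0$.
  obtain ⟨y, hy, e⟩ := hI.norm_mem hDC _ (hI.res_mem hDH x hx)
  refine ⟨y, hy, ?_⟩
  have h1 : (⊤ : Subgroup (D.map H.subtype)).map (Subgroup.inclusion hDH) = D := by
    rw [← MonoidHom.range_eq_map, Subgroup.inclusion_range]
    exact Subgroup.comap_map_eq_self_of_injective H.subtype_injective D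
  have h2 := congrArg (mark ⊤) e
  rw [map_add, mark_norm_zero, add_zero, mark_norm, Subgroup.comap_top, top_sup_eq,
    Subgroup.index_top, pow_one, res, mark_restrict, h1] at h2
  rwa [← h2]

/-! ### The families $\mathfrak p_{C,p}$ are prime -/

theorem isPrime_markFamily_Iic (C : Subgroup G) {p : ℕ} (hp : p.Prime ∨ p = 0) :
    IsPrime (markFamily (Set.Iic C) p) where
  isTambaraIdeal := isTambaraIdeal_markFamily (isLowerSet_Iic C) p
  proper h := by
    have h1 : (1 : obj C) ∈ markFamily (Set.Iic C) p C := h ▸ Submodule.mem_top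
    have h2 := mem_markFamily.mp h1 ⊤ (Subgroup.map_subtype_le _)
    rw [map_one, Int.natCast_dvd_ofNat, Nat.dvd_one] at h2
    rcases hp with hp | hp
    · exact hp.ne_one h2
    · omega
  le_or_le I J hI hJ h := by
    by_contra! hIJ
    obtain ⟨a, ha, ha'⟩ := exists_not_dvd_mark_top hI hIJ.1
    obtain ⟨b, hb, hb'⟩ := exists_not_dvd_mark_top hJ hIJ.2
    have hC : conjSubgroup C 1 = C := conjSubgroup_eq C 1
    -- A single summand with $g=1$ is $ab$ itself, up to the identification $C^1=C$; the transfer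
    -- then has index $1$ and preserves the mark at $C$.
    have h1 := h C ⟨1, fun _ => C, fun _ => 1, fun _ => hC.le, fun _ => a, fun _ => b,
      fun _ => ha, fun _ => hb, rfl⟩
    have h2 := mem_markFamily.mp h1 ⊤ (Subgroup.map_subtype_le _)
    have hr : (Subgroup.inclusion hC.le).range = ⊤ := by
      rw [Subgroup.inclusion_range, hC, Subgroup.subgroupOf_self]
    have hm : (⊤ : Subgroup (conjSubgroup C 1)).map (conjHom C 1) = ⊤ :=
      Subgroup.map_top_of_surjective _ fun x =>
        ⟨⟨x, hC.ge x.2⟩, Subtype.ext (by simp [conjHom])⟩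
    rw [Fin.sum_univ_one, tr, mark_induced (Subgroup.inclusion_injective _) hr.ge, hr,
      Subgroup.index_top, Nat.cast_one, one_mul, Subgroup.comap_top, conj, mark_restrict, hm,
      map_mul] at h2
    rcases hp with hp | rfl
    · exact ((Nat.prime_iff_prime_int.mp hp).dvd_or_dvd h2).elim ha' hb'
    · rw [Nat.cast_zero, zero_dvd_iff] at h2 ha' hb'
      exact (mul_eq_zero.mp h2).elim ha' hb'

/-! ### Every prime ideal is some $\mathfrak p_{C,p}$ -/

/-- The norm of $y$ gives $w\in P(G/H)$ with $\varphi^C(w)=\varphi^C(y)^m$. Then $\varphi^C(y)^m z$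
and $wz$ have the same mark at $C$, and modulo $p$ both vanish at the proper subgroups of $C$
because $z$ does; so they differ by an element of $\mathfrak p_{C,p}\subseteq P$. The exponent
$|G|\ge m$ serves all $H$ at once. -/
theorem pow_smul_mem {P : IdealFamily G} (hP : IsTambaraIdeal P) {C : Subgroup G} {p : ℕ}
    (hCP : markFamily (Set.Iic C) p ≤ P) {y : obj C} (hy : y ∈ P C) {H : Subgroup G} {z : obj H}
    (hz : z ∈ markFamily (Set.Iio C) p H) : mark ⊤ y ^ Nat.card G • z ∈ P H := by
  rw [mem_markFamily] at hz
  by_cases hCH : C ≤ H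
  · obtain ⟨w, hw, e⟩ := hP.norm_mem hCH y hy
    set m := (C.subgroupOf H ⊔ (Subgroup.inclusion hCH).range).index
    have h1 : mark (C.subgroupOf H) w = mark ⊤ y ^ m := by
      have h2 := congrArg (mark (C.subgroupOf H)) e
      have h3 : (C.subgroupOf H).comap (Subgroup.inclusion hCH) = ⊤ :=
        eq_top_iff.mpr fun x _ => x.2
      rw [map_add, mark_norm_zero, add_zero, mark_norm, h3] at h2
      exact h2.symm
    have h2 : mark ⊤ y ^ m • z - w * z ∈ P H := by
      refine hCP H (mem_markFamily.mpr fun I hI => ?_)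
      rw [map_sub, map_zsmul, map_mul, smul_eq_mul, ← sub_mul]
      rcases lt_or_eq_of_le (Set.mem_Iic.mp hI) with h | h
      · exact (hz I h).mul_left _
      · have h4 : I = C.subgroupOf H := by
          rw [← h]
          exact (Subgroup.comap_map_eq_self_of_injective H.subtype_injective I).symm
        rw [h4, h1, sub_self, zero_mul]
        exact dvd_zero _
    have h3 : mark ⊤ y ^ m • z ∈ P H :=
      sub_add_cancel (mark ⊤ y ^ m • z) (w * z) ▸ add_mem h2 ((P H).mul_mem_right z hw)
    have hmG : m ≤ Nat.card G :=
      (Nat.le_of_dvd Nat.card_pos (Subgroup.index_dvd_card _)).trans H.card_le_card_group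
    rw [← Nat.sub_add_cancel hmG, pow_add, mul_smul]
    exact zsmul_mem h3 _
  -- When $C\not\le H$, no subgroup of $H$ equals $C$, so $z$ already lies in $\mathfrak p_{C,p}$.
  · refine zsmul_mem (hCP H (mem_markFamily.mpr fun I hI =>
      hz I ((Set.mem_Iic.mp hI).lt_of_ne ?_))) _
    rintro rfl
    exact hCH (Subgroup.map_subtype_le I)

/-- Take $S$ minimal among the lower sets with `markFamily S p ≤ P`, and $D$ maximal in $S$. The
ideals of `Set.Iic D` and of `S \ {D}` multiply into that of $S$, so $P$ contains one of them, and
minimality excludes the second. Minimality also excludes `Set.Iio D`, a lower set inside $S$ that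
misses $D$. -/
theorem IsPrime.exists_markFamily_Iic_le {P : IdealFamily G} (hP : IsPrime P) {p : ℕ}
    (h : markFamily Set.univ p ≤ P) :
    ∃ C, markFamily (Set.Iic C) p ≤ P ∧ ¬ markFamily (Set.Iio C) p ≤ P := by
  obtain ⟨S, ⟨hS, hSP⟩, hmin⟩ := (Set.toFinite
    {S : Set (Subgroup G) | IsLowerSet S ∧ markFamily S p ≤ P}).exists_minimal
    ⟨Set.univ, isLowerSet_univ, h⟩
  have hne : S.Nonempty := by
    rw [Set.nonempty_iff_ne_empty]
    rintro rfl
    exact hP.proper (top_le_iff.mp fun H x _ =>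
      hSP H (mem_markFamily.mpr fun I hI => (Set.notMem_empty _ hI).elim))
  obtain ⟨D, hDS, hD⟩ := (Set.toFinite S).exists_maximal hne
  have hlow : IsLowerSet (S \ {D}) := fun A B hBA hA =>
    ⟨hS hBA hA.1, fun hB => hA.2 (le_antisymm (hD hA.1 (hB ▸ hBA)) (hB ▸ hBA))⟩
  have hDP : markFamily (Set.Iic D) p ≤ P := by
    refine (hP.le_or_le_of_mul_mem (isTambaraIdeal_markFamily (isLowerSet_Iic D) p)
      (isTambaraIdeal_markFamily hlow p) fun H a ha b hb => ?_).resolve_right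
      fun h1 => (hmin ⟨hlow, h1⟩ Set.sdiff_subset hDS).2 rfl
    refine hSP H (mem_markFamily.mpr fun I hI => ?_)
    rw [map_mul]
    by_cases hID : I.map H.subtype = D
    · exact (mem_markFamily.mp ha I hID.le).mul_right _
    · exact (mem_markFamily.mp hb I ⟨hI, hID⟩).mul_left _
  refine ⟨D, hDP, fun h1 => ?_⟩
  exact lt_irrefl D (hmin ⟨isLowerSet_Iio D, h1⟩ (fun A hA => hS (le_of_lt hA) hDS) hDS)

/-- The ideals for $q$ and $n$ multiply into the ideal for $qn$, so primality splits off one prime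
factor at a time; $n=1$ would give the whole functor. -/
theorem IsPrime.exists_prime_markFamily_univ_le {P : IdealFamily G} (hP : IsPrime P) {n : ℕ}
    (hn : n ≠ 0) (h : markFamily Set.univ n ≤ P) :
    ∃ q : ℕ, q.Prime ∧ markFamily Set.univ q ≤ P := by
  induction n using induction_on_primes with
  | zero => exact (hn rfl).elim
  | one =>
    exact (hP.proper (top_le_iff.mp fun H x _ =>
      h H (mem_markFamily_of_forall_dvd fun I => by simp))).elim
  | prime_mul q n hq ih =>
    rcases hP.le_or_le_of_mul_mem (isTambaraIdeal_markFamily isLowerSet_univ q)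
      (isTambaraIdeal_markFamily isLowerSet_univ n) (fun H a ha b hb => h H
        (mem_markFamily.mpr fun I hI => by
          rw [map_mul, Nat.cast_mul]
          exact mul_dvd_mul (mem_markFamily.mp ha I hI) (mem_markFamily.mp hb I hI))) with h1 | h1
    · exact ⟨q, hq, h1⟩
    · exact ih (right_ne_zero_of_mul hn) h1

/-- If `P` contains `p_{C,p}` properly, then it contains the ideal defined by the marks modulo `p`
at the proper subgroups of `C`. -/
theorem markFamily_Iio_le_of_prime {P : IdealFamily G} (hP : IsTambaraIdeal P) {C : Subgroup G}
    {p : ℕ} (hp : p.Prime) (hCP : markFamily (Set.Iic C) p ≤ P)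
    (hPC : ¬ P ≤ markFamily (Set.Iic C) p) : markFamily (Set.Iio C) p ≤ P := by
  obtain ⟨y, hy, hn⟩ := exists_not_dvd_mark_top hP hPC
  intro H z hz
  -- Both $\varphi^C(y)^{|G|}z$ and $pz$ lie in $P$, and the two coefficients are coprime, so Bézout
  -- gives $z\in P$.
  have hcop : IsCoprime (mark ⊤ y ^ Nat.card G) (p : ℤ) :=
    (((Nat.prime_iff_prime_int.mp hp).coprime_iff_not_dvd).mpr hn).symm.pow_left
  obtain ⟨a, b, hab⟩ := hcop
  have h1 : (p : ℤ) • z ∈ P H := hCP H (mem_markFamily_of_forall_dvd fun I => by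
    rw [map_zsmul]
    exact dvd_mul_right _ _)
  rw [← one_smul ℤ z, ← hab, add_smul, mul_smul, mul_smul]
  exact add_mem (zsmul_mem (pow_smul_mem hP hCP hy hz) a) (zsmul_mem h1 b)

/-- In characteristic $0$ the integer $\varphi^C(y)^{|G|}$ cannot be inverted. It is instead
supplied by a second factor: elements with all marks divisible by $|G|m$, where
$m=|\varphi^C(y)^{|G|}|$, are multiples of $m$ in $A(H)$. -/
theorem IsPrime.markFamily_Iio_zero_le_or {P : IdealFamily G} (hP : IsPrime P) {C : Subgroup G}
    (hCP : markFamily (Set.Iic C) 0 ≤ P) (hPC : ¬ P ≤ markFamily (Set.Iic C) 0) :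
    markFamily (Set.Iio C) 0 ≤ P ∨ ∃ n : ℕ, n ≠ 0 ∧ markFamily Set.univ n ≤ P := by
  obtain ⟨y, hy, hn⟩ := exists_not_dvd_mark_top hP.isTambaraIdeal hPC
  rw [Nat.cast_zero, zero_dvd_iff] at hn
  set m := (mark ⊤ y ^ Nat.card G).natAbs
  refine (hP.le_or_le_of_mul_mem (isTambaraIdeal_markFamily (isLowerSet_Iio C) 0)
    (isTambaraIdeal_markFamily isLowerSet_univ (Nat.card G * m)) fun H a ha b hb => ?_).imp_right
    fun h => ⟨_, mul_ne_zero Nat.card_pos.ne' (Int.natAbs_ne_zero.mpr (pow_ne_zero _ hn)), h⟩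
  obtain ⟨b', rfl⟩ : ∃ b', b = m • b' := exists_eq_nsmul fun I =>
    (Int.natCast_dvd_natCast.mpr (mul_dvd_mul_right H.card_subgroup_dvd_card m)).trans
      (mem_markFamily.mp hb I (Set.mem_univ _))
  obtain ⟨c, hc⟩ : mark ⊤ y ^ Nat.card G ∣ (m : ℤ) := Int.dvd_natAbs.mpr dvd_rfl
  rw [mul_smul_comm, ← smul_mul_assoc, ← natCast_zsmul, hc, mul_comm (_ ^ _) c, mul_smul]
  exact (P H).mul_mem_right _ (zsmul_mem (pow_smul_mem hP.isTambaraIdeal hCP hy ha) c)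

/-- Marks are jointly injective, so this family is zero; it starts the search for $C$ when $p=0$. -/
theorem markFamily_univ_zero_le (P : IdealFamily G) : markFamily Set.univ 0 ≤ P := by
  intro H x hx
  have h : x = 0 := eq_zero_of_mark_eq_zero fun I =>
    zero_dvd_iff.mp (mem_markFamily.mp hx I (Set.mem_univ _))
  exact h ▸ zero_mem _

theorem IsPrime.exists_eq_markFamily {P : IdealFamily G} (hP : IsPrime P) :
    ∃ (C : Subgroup G) (p : ℕ), (p.Prime ∨ p = 0) ∧ P = markFamily (Set.Iic C) p := by
  by_cases h : ∃ q : ℕ, q.Prime ∧ markFamily Set.univ q ≤ P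
  · obtain ⟨p, hp, hpP⟩ := h
    obtain ⟨C, hC, hC'⟩ := hP.exists_markFamily_Iic_le hpP
    exact ⟨C, p, Or.inl hp, le_antisymm
      (not_not.mp fun h => hC' (markFamily_Iio_le_of_prime hP.isTambaraIdeal hp hC h)) hC⟩
  · obtain ⟨C, hC, hC'⟩ := hP.exists_markFamily_Iic_le (markFamily_univ_zero_le P)
    refine ⟨C, 0, Or.inr rfl, le_antisymm (not_not.mp fun h1 => ?_) hC⟩
    -- By the choice of $C$ only the alternative with a nonzero $n$ remains, and a prime factor of
    -- $n$ contradicts the case assumption.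
    obtain ⟨n, hn, hnP⟩ := (hP.markFamily_Iio_zero_le_or hC h1).resolve_left hC'
    exact h (hP.exists_prime_markFamily_univ_le hn hnP)

/-- The spectrum of the Burnside Tambara functor of a finite abelian group. -/
theorem spec_eq : spec G =
    {P | ∃ (C : Subgroup G) (p : ℕ), (p.Prime ∨ p = 0) ∧ P = primeFamily C p} := by
  simp only [primeFamily_eq_markFamily]
  ext P
  constructor
  · exact IsPrime.exists_eq_markFamily
  · rintro ⟨C, p, hp, rfl⟩
    exact isPrime_markFamily_Iic C hp

end BurnsideTambara

theorem theorem5p4 (G : Type u) [Group G] [Finite G] [IsCyclic G] :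
    BurnsideTambara.spec G =
      {P | ∃ (C : Subgroup G) (p : ℕ), (p.Prime ∨ p = 0) ∧
        P = BurnsideTambara.primeFamily C p} :=
  letI : CommGroup G := IsCyclic.commGroup
  BurnsideTambara.spec_eq
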